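/- Let $d\in\mathbb N$, let $D\subseteq\mathbb R^d$ be a Borel set and $\rho$ a probability density on $D$ with respect to Lebesgue measure, and let $G=L_2(D,\rho(x)\,dx)$. Let $F$ be a separable Hilbert space (real or complex) of functions on $D$ that embeds compactly into $G$; point evaluations on $F$ need not be continuous, and the elements of $F$ may be defined only almost everywhere (then suprema over $f$ run over all representatives). *Worst case errors.* For $n\ge1$ let $$e^{\rm wor}(n;\Lambda^{\rm all})=\inf\ \sup_{f\in F,\ \|f\|_F\le1}\big\|f-\varphi(L_1f,\dots,L_nf)\big\|_G ,$$ the infimum being over all (not necessarily continuous) linear functionals $L_1,\dots,L_n$ on $F$ and all measurable $\varphi$ from $n$-tuples of scalars to $G$. *Randomized errors.* A randomized algorithm using function values is a family $A^\omega$, indexed by a probability space, such that for each $\omega$ the method samples $f$ at points $x_{1,\omega},x_{2,\omega},\dots\in D$, stops after $n(f,\omega)$ samples, where the decision to stop depends only on $\omega$ and the values seen so far, and returns an element $A^\omega(f)$ of $G$ depending only on $\omega$ and the computed values (with the natural measurability). Its cardinality is $\sup_{\|f\|_F\le1}\mathbb E_\omega\, n(f,\omega)$ and its error is $\sup_{\|f\|_F\le1}\big(\mathbb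 E_\omega\|f-A^\omega(f)\|_G^2\big)^{1/2}$. For $n\ge1$, $e^{\rm ran}(n;\Lambda^{\rm std})$ is the infimum of the errors of all such algorithms of cardinality at most $n$. For $n=0$ only the zero algorithm is used: $e^{\rm wor}(0;\Lambda^{\rm all})=e^{\rm ran}(0;\Lambda^{\rm std})=\sup_{\|f\|_F\le1}\|f\|_G$. *Information complexity.* For $\star\in\{{\rm ABS},{\rm NOR}\}$ and $\varepsilon>0$ let $$n^{{\rm wor},\star}(\varepsilon;\Lambda^{\rm all})=\inf\{n\ge0: e^{\rm wor}(n;\Lambda^{\rm all})\le\varepsilon\,{\rm CRI}\},\qquad n^{{\rm ran},\star}(\varepsilon;\Lambda^{\rm std})=\inf\{n\ge0: e^{\rm ran}(n;\Lambda^{\rm std})\le\varepsilon\,{\rm CRI}\},$$ where ${\rm CRI}=1$ for $\star={\rm ABS}$ (absolute criterion) and ${\rm CRI}=\sup_{\|f\|_F\le1}\|f\|_G$ for $\star={\rm NOR}$ (normalized criterion). **Theorem.** Let $\star\in\{{\rm ABS},{\rm NOR}\}$. (a) For every $\varepsilon>0$, the number $N=n^{{\rm wor},\star}(\varepsilon/4;\Lambda^{\rm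 all})$ is finite and $$n^{{\rm ran},\star}(\varepsilon;\Lambda^{\rm std})\le 96\sqrt2\,(N+1)\big(\ln(N+1)+\ln(192\sqrt2)\big).$$ (b) For $0<\delta<1$ put $A_\delta=\Big(1+\frac{1}{12\ln(1/\delta)}\Big)^{1/2}\frac1{\sqrt{1-\delta}}$. Then $A_\delta\to1$ as $\delta\to0^+$, and there is $\delta_0\in(0,1)$, independent of $d,D,\rho,F,\star,\varepsilon$, such that for all $\delta\in(0,\delta_0)$ and all $\varepsilon>0$ the number $N'=n^{{\rm wor},\star}(\varepsilon/A_\delta;\Lambda^{\rm all})$ is finite and $$n^{{\rm ran},\star}(\varepsilon;\Lambda^{\rm std})\le 48\Big(4\big(\ln48+\ln\ln\tfrac1\delta+\ln(N'+1)\big)+\ln\tfrac1\delta\Big)(N'+1).$$ -/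

import Mathlib

open MeasureTheory
open scoped ENNReal NNReal

noncomputable section

namespace RandApprox

/-- A Borel set `D ⊆ ℝ^d` with a probability density `ρ` on it (with respect to Lebesgue
measure).  The condition `∫_D ρ = 1` forces `D` to have positive Lebesgue measure. -/
structure WeightedDomain (d : ℕ) where
  D : Set (EuclideanSpace ℝ (Fin d))
  measurableSet_D : MeasurableSet D
  ρ : D → ℝ≥0
  measurable_ρ : Measurable ρ
  lintegral_ρ : ∫⁻ x, (ρ x : ℝ≥0∞) ∂(volume.comap (Subtype.val : D → EuclideanSpace ℝ (Fin d))) = 1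

/-- The measure `ρ(x) dx` on `D`. -/
def WeightedDomain.μ {d : ℕ} (W : WeightedDomain d) : Measure W.D :=
  (volume.comap (Subtype.val : W.D → EuclideanSpace ℝ (Fin d))).withDensity fun x => (W.ρ x : ℝ≥0∞)

/-- The weighted space `G = L₂(D, ρ(x) dx)`. -/
abbrev WeightedDomain.G {d : ℕ} (W : WeightedDomain d) (𝕜 : Type*) [RCLike 𝕜] : Type _ :=
  Lp 𝕜 2 W.μ

/-- The approximation problem: a Hilbert space `F` of functions on `D` that embeds compactly into
`G = L₂(D, ρ(x) dx)`.  (Completeness and separability of `F` are hypotheses of the theorem.)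

`E` is the vector space of the actual functions `D → 𝕜` whose values are sampled, and `cls f` is
the element of `F` given by the function `f`.  If the elements of `F` are genuine functions, then
`cls` is a bijection.  If function values are defined only almost everywhere, then several
functions, equal almost everywhere, represent one element of `F`.  In all cases the embedding
`app` is `f ↦ f`.  Point evaluations need not be continuous on `F`. -/
structure Problem {d : ℕ} (W : WeightedDomain d) (𝕜 : Type*) [RCLike 𝕜] (F : Type*)
    [NormedAddCommGroup F] [InnerProductSpace 𝕜 F] where
  E : Submodule 𝕜 (W.D → 𝕜)
  cls : E →ₗ[𝕜] F
  cls_surjective : Function.Surjective cls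
  app : F →L[𝕜] W.G 𝕜
  isCompactOperator_app : IsCompactOperator app
  app_cls : ∀ f : E, (app (cls f) : W.D → 𝕜) =ᵐ[W.μ] (f : W.D → 𝕜)

/-- The two error criteria. -/
inductive Criterion
  | ABS
  | NOR

variable {d : ℕ} {W : WeightedDomain d} {𝕜 : Type*} [RCLike 𝕜] {F : Type*}
  [NormedAddCommGroup F] [InnerProductSpace 𝕜 F]

/-- The error of the zero algorithm, `sup_{‖f‖ ≤ 1} ‖APP f‖`. -/
def initialError (P : Problem W 𝕜 F) : ℝ≥0∞ :=
  ⨆ (f : F) (_ : ‖f‖ ≤ 1), ‖P.app f‖ₑ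

/-! ### Worst case setting, arbitrary linear information -/

/-- An algorithm `f ↦ φ(L₁ f, …, Lₙ f)` with linear functionals `Lᵢ` on `F`, not necessarily
continuous, and a measurable `φ : 𝕜ⁿ → G`. -/
structure WorAlg (P : Problem W 𝕜 F) (n : ℕ) where
  L : Fin n → (F →ₗ[𝕜] 𝕜)
  φ : (Fin n → 𝕜) → W.G 𝕜
  stronglyMeasurable_φ : StronglyMeasurable φ

/-- The worst case error of an algorithm. -/
def WorAlg.error {P : Problem W 𝕜 F} {n : ℕ} (A : WorAlg P n) : ℝ≥0∞ :=
  ⨆ (f : F) (_ : ‖f‖ ≤ 1), ‖P.app f - A.φ (fun i => A.L i f)‖ₑ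

/-- The `n`th minimal worst case error `e^wor(n; Λ^all)`; only the zero algorithm is used for
`n = 0`. -/
def eWor (P : Problem W 𝕜 F) (n : ℕ) : ℝ≥0∞ :=
  if n = 0 then initialError P else ⨅ A : WorAlg P n, A.error

/-! ### Randomized setting, function values -/

/-- A random family of methods using function values of `f : D → 𝕜`.  For each `ω` the method
samples `f` at `point 0 ω, point 1 ω, …` in turn and halts as soon as the values `y` seen so far
satisfy the stopping rule `halt`; if `k` values have been computed then, its output is
`out k ω y`. -/
structure RanMethod {d : ℕ} (W : WeightedDomain d) (𝕜 : Type*) [RCLike 𝕜] where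
  Ω : Type
  [measurableSpace : MeasurableSpace Ω]
  ℙ : Measure Ω
  [isProbabilityMeasure : IsProbabilityMeasure ℙ]
  point : ℕ → Ω → W.D
  halt : (k : ℕ) → Ω → (Fin k → 𝕜) → Prop
  out : (k : ℕ) → Ω → (Fin k → 𝕜) → W.G 𝕜

attribute [instance] RanMethod.measurableSpace RanMethod.isProbabilityMeasure

/-- The number `n(f, ω)` of function values used, `∞` if the method does not halt. -/
def RanMethod.cost (A : RanMethod W 𝕜) (f : W.D → 𝕜) (ω : A.Ω) : ℝ≥0∞ :=
  ⨅ (k : ℕ) (_ : A.halt k ω fun i => f (A.point i ω)), (k : ℝ≥0∞)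

open Classical in
/-- The output `A^ω(f)`.  The value `0` for a run that does not halt is immaterial: such runs have
probability zero if the expected number of function values is finite. -/
def RanMethod.run (A : RanMethod W 𝕜) (f : W.D → 𝕜) (ω : A.Ω) : W.G 𝕜 :=
  if h : ∃ k : ℕ, A.halt k ω fun i => f (A.point i ω) then
    A.out (Nat.find h) ω fun i => f (A.point i ω)
  else 0

/-- A randomized algorithm for the problem `P` using function values: the sample points, the
number of samples used and the output are random variables, and for fixed `ω` the method is
measurable in the data. -/
structure RanAlg (P : Problem W 𝕜 F) extends RanMethod W 𝕜 where
  measurable_point : ∀ j, Measurable (point j)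
  measurableSet_halt : ∀ k ω, MeasurableSet {y | halt k ω y}
  stronglyMeasurable_out : ∀ k ω, StronglyMeasurable (out k ω)
  aemeasurable_cost : ∀ f ∈ P.E, AEMeasurable (toRanMethod.cost f) ℙ
  aestronglyMeasurable_run : ∀ f ∈ P.E, AEStronglyMeasurable (toRanMethod.run f) ℙ

/-- `Card(A) = sup_{‖f‖ ≤ 1} 𝔼 n(f, ω)`. -/
def RanAlg.card {P : Problem W 𝕜 F} (A : RanAlg P) : ℝ≥0∞ :=
  ⨆ (f : P.E) (_ : ‖P.cls f‖ ≤ 1), ∫⁻ ω, A.cost (f : W.D → 𝕜) ω ∂A.ℙ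

/-- `e^ran(A) = sup_{‖f‖ ≤ 1} (𝔼 ‖APP f - A^ω(f)‖²)^{1/2}`. -/
def RanAlg.error {P : Problem W 𝕜 F} (A : RanAlg P) : ℝ≥0∞ :=
  ⨆ (f : P.E) (_ : ‖P.cls f‖ ≤ 1),
    (∫⁻ ω, ‖P.app (P.cls f) - A.run (f : W.D → 𝕜) ω‖ₑ ^ 2 ∂A.ℙ) ^ (1 / 2 : ℝ)

/-- The `n`th minimal randomized error `e^ran(n; Λ^std)`; only the zero algorithm is used for
`n = 0`. -/
def eRan (P : Problem W 𝕜 F) (n : ℕ) : ℝ≥0∞ :=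
  if n = 0 then initialError P else ⨅ (A : RanAlg P) (_ : A.card ≤ n), A.error

/-! ### Information complexities -/

/-- The smallest `n` with `e n ≤ ε · CRI`, where `CRI` is `1` (absolute criterion) or the initial
error `e 0` (normalized criterion); `⊤` if there is none. -/
def complexity (e : ℕ → ℝ≥0∞) (c : Criterion) (ε : ℝ) : ℕ∞ :=
  ⨅ (n : ℕ) (_ : e n ≤ ENNReal.ofReal ε * (match c with
    | .ABS => 1
    | .NOR => e 0)), (n : ℕ∞)

/-- `n^{wor,⋆}(ε; Λ^all)`. -/
def nWor (P : Problem W 𝕜 F) (c : Criterion) (ε : ℝ) : ℕ∞ := complexity (eWor P) c ε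

/-- `n^{ran,⋆}(ε; Λ^std)`. -/
def nRan (P : Problem W 𝕜 F) (c : Criterion) (ε : ℝ) : ℕ∞ := complexity (eRan P) c ε

/-- `A_δ = (1 + 1 / (12 ln (1/δ)))^{1/2} (1 - δ)^{-1/2}`. -/
def Aδ (δ : ℝ) : ℝ := √(1 + 1 / (12 * Real.log (1 / δ))) * (1 / √(1 - δ))

end RandApprox

end

/-! Write T for the embedding of F into G. An algorithm using n functionals cannot separate u from
-u when all functionals vanish at u, and every (n+1)-dimensional subspace contains such a u ≠ 0. So
worst case error at most t forces T to shrink some vector of each such subspace by the factor t. By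
the spectral theorem for T*T, at most n eigenvalues, counted with multiplicity, exceed t², and the
images of their eigenvectors span a space V of dimension m ≤ n within distance t of T(f) for every f
in the unit ball (`exists_submodule_of_eWor_le`).

It remains to estimate the coefficients of f in an orthonormal basis φ of V from random samples,
with mean square error C‖g‖², where g is the part of f orthogonal to V. Interpolation at m points of
the projection determinantal process achieves C = m (`coeffEstimable_fin`): by Cramer's rule the
determinant in the denominator cancels against the density, and Andréief's identity evaluates what
is left. Estimating the coefficients of the residual by s importance samples from the Christoffel
density replaces C by (m/s)(1 + C) (`CoeffEstimable.refine`). With s = 2m the map C ↦ (1 + C)/2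
contracts towards 1, so about log₂ m rounds bring C below 2, and one last round with s = mR gives C
≤ 3/R.

By Pythagoras the final error is at most (1 + 3/R)^{1/2} t, at the cost of m(1 + 2k + R) samples
with k of order log₂ n. Both bounds follow by choosing R. -/

noncomputable section

namespace RandApprox

/-! ### Spectral theory of compact operators between Hilbert spaces -/

section Spectral

variable {𝕜 F H : Type*} [RCLike 𝕜] [NormedAddCommGroup F] [InnerProductSpace 𝕜 F]
  [NormedAddCommGroup H] [InnerProductSpace 𝕜 H]

open Module.End

/-- On a sum of eigenvectors of a symmetric operator, the quadratic form is the sum of the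
eigenvalues weighted by squared norms. -/
theorem exists_eigen_sum {S : F →ₗ[𝕜] F} (hS : S.IsSymmetric)
    {p : 𝕜 → Prop} {u : F} (hu : u ∈ ⨆ l : {l // p l}, eigenspace S l.1) :
    ∃ (s : Finset {l // p l}) (c : {l // p l} → ℝ),
      ‖u‖ ^ 2 = ∑ l ∈ s, c l ^ 2 ∧
      RCLike.re (inner 𝕜 (S u) u) = ∑ l ∈ s, RCLike.re l.1 * c l ^ 2 := by
  classical
  rw [Submodule.mem_iSup_iff_exists_finsupp] at hu
  obtain ⟨f, hf, rfl⟩ := hu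
  have horth := hS.orthogonalFamily_eigenspaces.comp
    (Subtype.val_injective : Function.Injective (Subtype.val : {l // p l} → 𝕜))
  have h1 : (f.sum fun _ x => x) = ∑ l ∈ f.support,
      ((eigenspace S l.1).subtypeₗᵢ) ⟨f l, hf l⟩ := rfl
  have h2 : S (f.sum fun _ x => x) = ∑ l ∈ f.support,
      ((eigenspace S l.1).subtypeₗᵢ) (l.1 • ⟨f l, hf l⟩) := by
    rw [Finsupp.sum, map_sum]
    exact Finset.sum_congr rfl fun l _ => mem_eigenspace_iff.1 (hf l)
  refine ⟨f.support, fun l => ‖f l‖, ?_, ?_⟩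
  · rw [h1]
    exact horth.norm_sum _ _
  · rw [h2, h1]
    have h3 := horth.inner_sum (fun l => l.1 • ⟨f l, hf l⟩) (fun l => ⟨f l, hf l⟩) f.support
    rw [h3, map_sum]
    refine Finset.sum_congr rfl fun l _ => ?_
    rw [inner_smul_left, inner_self_eq_norm_sq_to_K]
    rw [← RCLike.ofReal_pow, RCLike.re_mul_ofReal, RCLike.conj_re]
    rfl

/-- The image of the unit ball under a compact operator is approximated by finite-dimensional
subspaces. -/
theorem exists_finiteDimensional_forall_norm_sub_le (T : F →L[𝕜] H) (hT : IsCompactOperator T)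
    {t : ℝ} (ht : 0 < t) :
    ∃ V : Submodule 𝕜 H, FiniteDimensional 𝕜 V ∧
      ∀ f, ‖f‖ ≤ 1 → ∃ v ∈ V, ‖T f - v‖ ≤ t := by
  obtain ⟨K, hK, hsub⟩ := IsCompactOperator.image_closedBall_subset_compact (f := (T : F →ₗ[𝕜] H)) hT 1
  obtain ⟨s, hs, hfin, hcov⟩ := hK.finite_cover_balls ht
  refine ⟨Submodule.span 𝕜 s, FiniteDimensional.span_of_finite 𝕜 hfin, fun f hf => ?_⟩
  have : T f ∈ K := hsub ⟨f, by simpa using hf, rfl⟩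
  obtain ⟨v, hv, hmem⟩ := Set.mem_iUnion₂.1 (hcov this)
  exact ⟨v, Submodule.subset_span hv, by
    rw [← dist_eq_norm]; exact (Metric.mem_ball.1 hmem).le⟩

variable [CompleteSpace F] [CompleteSpace H]

/-- If a compact operator `T` shrinks some vector of every `(m+1)`-dimensional subspace by the
factor `t`, then its range is approximated with the same factor by a subspace of dimension at
most `m`. -/
theorem exists_submodule_forall_norm_sub_le (T : F →L[𝕜] H) (hT : IsCompactOperator T) {t : ℝ}
    (ht : 0 ≤ t) {m : ℕ}
    (h : ∀ U : Submodule 𝕜 F, Module.finrank 𝕜 U = m + 1 → ∃ u ∈ U, u ≠ 0 ∧ ‖T u‖ ≤ t * ‖u‖) :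
    ∃ V : Submodule 𝕜 H, FiniteDimensional 𝕜 V ∧ Module.finrank 𝕜 V ≤ m ∧
      ∀ f, ∃ v ∈ V, ‖T f - v‖ ≤ t * ‖f‖ := by
  set S : F →L[𝕜] F := T.adjoint ∘L T with hSdef
  have hS : (S : F →ₗ[𝕜] F).IsSymmetric := fun x y => by
    simp [hSdef, ContinuousLinearMap.adjoint_inner_left, ContinuousLinearMap.adjoint_inner_right]
  have hSc : IsCompactOperator S := hT.clm_comp T.adjoint
  have hq : ∀ x, ‖T x‖ ^ 2 = RCLike.re (inner 𝕜 (S x) x) :=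
    T.apply_norm_sq_eq_inner_adjoint_left
  set U : Submodule 𝕜 F := ⨆ l : {l : 𝕜 // t ^ 2 < RCLike.re l}, eigenspace (S : F →ₗ[𝕜] F) l.1
  set U' : Submodule 𝕜 F := ⨆ l : {l : 𝕜 // ¬ t ^ 2 < RCLike.re l},
    eigenspace (S : F →ₗ[𝕜] F) l.1
  -- The weights λ - t² are strictly positive on U, so a nonpositive weighted sum of squares kills
  -- every component of u.
  have hU : ∀ u ∈ U, ‖T u‖ ≤ t * ‖u‖ → u = 0 := by
    intro u hu hle
    obtain ⟨s, c, h1, h2⟩ := exists_eigen_sum hS hu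
    have h3 : ‖T u‖ ^ 2 ≤ t ^ 2 * ‖u‖ ^ 2 := by
      rw [← mul_pow]; gcongr
    rw [hq u] at h3
    have h4 : ∑ l ∈ s, (RCLike.re l.1 - t ^ 2) * c l ^ 2 ≤ 0 := by
      simp only [sub_mul, Finset.sum_sub_distrib, ← Finset.mul_sum]
      rw [← h1]
      exact sub_nonpos.2 (h2 ▸ h3)
    have h5 : ∀ l ∈ s, 0 ≤ (RCLike.re l.1 - t ^ 2) * c l ^ 2 := fun l _ =>
      mul_nonneg (sub_nonneg.2 l.2.le) (sq_nonneg _)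
    have h6 := (Finset.sum_eq_zero_iff_of_nonneg h5).1 (le_antisymm h4 (Finset.sum_nonneg h5))
    have h7 : ‖u‖ ^ 2 = 0 := by
      rw [h1]
      refine Finset.sum_eq_zero fun l hl => ?_
      exact (mul_eq_zero.1 (h6 l hl)).resolve_left (sub_ne_zero.2 l.2.ne')
    simpa using h7
  have hU' : ∀ w ∈ U', ‖T w‖ ≤ t * ‖w‖ := by
    intro u hu
    obtain ⟨s, c, h1, h2⟩ := exists_eigen_sum hS hu
    refine le_of_sq_le_sq ?_ (by positivity)
    rw [hq u, mul_pow, h1, Finset.mul_sum]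
    refine h2.le.trans (Finset.sum_le_sum fun l _ => ?_)
    exact mul_le_mul_of_nonneg_right (not_lt.1 l.2) (sq_nonneg _)
  -- Any m + 1 independent vectors of U would span a space to which `h` applies, against `hU`.
  have hrank : Module.rank 𝕜 U ≤ m := by
    refine rank_le fun s hs => ?_
    by_contra! hcard
    obtain ⟨s', hs', hcard'⟩ := Finset.exists_subset_card_eq (Nat.succ_le_of_lt hcard)
    have hli : LinearIndependent 𝕜 (fun i : s' => ((i : U) : F)) :=
      (hs.comp (fun i : s' => (⟨i, hs' i.2⟩ : s)) fun a b hab =>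
        Subtype.ext (congrArg (fun x : s => (x : U)) hab)).map' U.subtype U.ker_subtype
    obtain ⟨u, hu, hu0, hle⟩ := h (Submodule.span 𝕜 (Set.range fun i : s' => ((i : U) : F)))
      (by rw [finrank_span_eq_card hli]; simpa using hcard')
    refine hu0 (hU u (Submodule.span_le.2 ?_ hu) hle)
    rintro _ ⟨i, rfl⟩
    exact i.1.2
  have hfin : FiniteDimensional 𝕜 U :=
    Module.rank_lt_aleph0_iff.1 (hrank.trans_lt (Cardinal.natCast_lt_aleph0))
  have horth : ∀ x ∈ U, ∀ y ∈ U', inner 𝕜 x y = 0 := by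
    have : U ⟂ U' := by
      rw [Submodule.isOrtho_iSup_left]
      intro l
      rw [Submodule.isOrtho_iSup_right]
      intro l'
      exact hS.orthogonalFamily_eigenspaces.isOrtho fun hll =>
        l'.2 (hll ▸ l.2)
    intro x hx y hy
    exact this.inner_eq hx hy
  -- The bound `hU'` passes to the closure of U', and this closure contains Uᗮ: the component of w
  -- orthogonal to it is orthogonal to all eigenspaces of T*T, hence zero.
  have hclos : ∀ w ∈ Uᗮ, ‖T w‖ ≤ t * ‖w‖ := by
    intro w hw
    have hmem : w ∈ U'.topologicalClosure := by
      have hz : w - U'.topologicalClosure.starProjection w ∈ U'.topologicalClosureᗮ :=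
        Submodule.sub_starProjection_mem_orthogonal w
      have hp : U'.topologicalClosure.starProjection w ∈ Uᗮ := by
        have hle : U'.topologicalClosure ≤ Uᗮ :=
          U'.topologicalClosure_minimal (fun y hy x hx => horth x hx y hy)
            (Submodule.isClosed_orthogonal U)
        exact hle (Submodule.starProjection_apply_mem _ _)
      have hzU := Submodule.sub_mem _ hw hp
      have hz0 : w - U'.topologicalClosure.starProjection w ∈
          (⨆ l, eigenspace (S : F →ₗ[𝕜] F) l)ᗮ := by
        rw [← Submodule.iInf_orthogonal, Submodule.mem_iInf]
        intro l
        by_cases hl : t ^ 2 < RCLike.re l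
        · exact Submodule.orthogonal_le
            (le_iSup (fun l : {l : 𝕜 // t ^ 2 < RCLike.re l} =>
              eigenspace (S : F →ₗ[𝕜] F) l.1) ⟨l, hl⟩) hzU
        · exact Submodule.orthogonal_le
            ((le_iSup (fun l : {l : 𝕜 // ¬ t ^ 2 < RCLike.re l} =>
              eigenspace (S : F →ₗ[𝕜] F) l.1) ⟨l, hl⟩).trans U'.le_topologicalClosure) hz
      rw [ContinuousLinearMap.orthogonalComplement_iSup_eigenspaces_eq_bot hSc hS,
        Submodule.mem_bot, sub_eq_zero] at hz0
      rw [hz0]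
      exact Submodule.starProjection_apply_mem _ _
    refine closure_minimal (s := (U' : Set F)) (t := {w | ‖T w‖ ≤ t * ‖w‖}) hU' ?_ hmem
    exact isClosed_le (by fun_prop) (by fun_prop)
  refine ⟨U.map (T : F →ₗ[𝕜] H), inferInstance, ?_, fun f => ⟨T (U.starProjection f),
    Submodule.mem_map_of_mem (Submodule.starProjection_apply_mem _ _), ?_⟩⟩
  · refine (Submodule.finrank_map_le _ _).trans ?_
    exact Module.finrank_le_of_rank_le hrank
  · rw [← map_sub]
    refine (hclos _ (Submodule.sub_starProjection_mem_orthogonal f)).trans ?_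
    gcongr
    rw [← Submodule.starProjection_orthogonal_val]
    exact (Submodule.norm_starProjection_apply_le _ f)

end Spectral

/-! ### Worst case errors and approximating subspaces -/

section Worst

theorem exists_orthonormal_norm_sub_le {𝕜 H : Type*} [RCLike 𝕜] [NormedAddCommGroup H]
    [InnerProductSpace 𝕜 H] (V : Submodule 𝕜 H) [FiniteDimensional 𝕜 V] :
    ∃ φ : Fin (Module.finrank 𝕜 V) → H, Orthonormal 𝕜 φ ∧
      ∀ x, ∀ v ∈ V, ‖x - ∑ j, inner 𝕜 (φ j) x • φ j‖ ≤ ‖x - v‖ := by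
  have b := stdOrthonormalBasis 𝕜 V
  refine ⟨fun j => (b j : H), b.orthonormal.comp_linearIsometry V.subtypeₗᵢ, fun x v hv => ?_⟩
  have h : ∑ j, inner 𝕜 (b j : H) x • (b j : H) = V.starProjection x := by
    simp [b.starProjection_eq_sum_rankOne]
  rw [h, Submodule.starProjection_minimal]
  exact ciInf_le ⟨0, by rintro _ ⟨y, rfl⟩; positivity⟩ (⟨v, hv⟩ : V)

/-- The infimum defining `eWor` need not be attained, and the bad vector found in U depends on the
algorithm. A minimizer on the unit sphere of U serves all algorithms at once. -/
theorem exists_isMin_norm_apply {𝕜 F H : Type*} [RCLike 𝕜] [NormedAddCommGroup F]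
    [NormedSpace 𝕜 F] [NormedAddCommGroup H] [NormedSpace 𝕜 H] (T : F →L[𝕜] H)
    (U : Submodule 𝕜 F) {n : ℕ} (hU : Module.finrank 𝕜 U = n + 1) :
    ∃ u₀ ∈ U, ‖u₀‖ = 1 ∧ ∀ u ∈ U, ‖u‖ = 1 → ‖T u₀‖ ≤ ‖T u‖ := by
  have : FiniteDimensional 𝕜 U := Module.finite_of_finrank_eq_succ hU
  have : Nontrivial U := Module.nontrivial_of_finrank_pos (R := 𝕜) (by omega)
  let : NormedSpace ℝ U := NormedSpace.restrictScalars ℝ 𝕜 U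
  have : ProperSpace U := FiniteDimensional.proper_rclike 𝕜 U
  obtain ⟨u₀, hu₀, hmin⟩ := (isCompact_sphere (0 : U) 1).exists_isMinOn
    (NormedSpace.sphere_nonempty.2 zero_le_one)
    (f := fun u : U => ‖T (u : F)‖) (by fun_prop)
  refine ⟨u₀, u₀.2, by simpa using hu₀, fun u hu hu1 => ?_⟩
  exact hmin (show (⟨u, hu⟩ : U) ∈ Metric.sphere (0 : U) 1 by simpa using hu1)

variable {d : ℕ} {W : WeightedDomain d} {𝕜 : Type*} [RCLike 𝕜] {F : Type*}
  [NormedAddCommGroup F] [InnerProductSpace 𝕜 F]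

/-- Some unit vector w of U is annihilated by all n functionals. Both w and -w then yield the output
φ(0), so one of the two errors is at least ‖T w‖. Continuity of the functionals plays no role. -/
theorem WorAlg.exists_enorm_le_error {P : Problem W 𝕜 F} {n : ℕ} (A : WorAlg P n)
    (U : Submodule 𝕜 F) (hU : Module.finrank 𝕜 U = n + 1) :
    ∃ u ∈ U, ‖u‖ = 1 ∧ ‖P.app u‖ₑ ≤ A.error := by
  have : FiniteDimensional 𝕜 U := Module.finite_of_finrank_eq_succ hU
  obtain ⟨u, hu, hu0⟩ := Submodule.exists_mem_ne_zero_of_ne_bot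
    (LinearMap.ker_ne_bot_of_finrank_lt (f := (LinearMap.pi A.L) ∘ₗ U.subtype)
      (by simp [hU]))
  have hu1 : (u : F) ≠ 0 := by simpa using hu0
  set w : F := ((‖(u : F)‖⁻¹ : ℝ) : 𝕜) • (u : F) with hw
  have hw1 : ‖w‖ = 1 := by
    rw [hw, norm_smul]
    simp [hu1]
  have hL : ∀ i, A.L i (u : F) = 0 := fun i => congrFun (LinearMap.mem_ker.1 hu) i
  have h1 : ‖P.app w - A.φ 0‖ₑ ≤ A.error := by
    refine le_trans (le_of_eq ?_) (le_iSup₂ (f := fun (f : F) (_ : ‖f‖ ≤ 1) =>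
      ‖P.app f - A.φ (fun i => A.L i f)‖ₑ) w hw1.le)
    congr 3; funext i; simp [hw, hL]
  have h2 : ‖P.app w + A.φ 0‖ₑ ≤ A.error := by
    refine le_trans (le_of_eq ?_) (le_iSup₂ (f := fun (f : F) (_ : ‖f‖ ≤ 1) =>
      ‖P.app f - A.φ (fun i => A.L i f)‖ₑ) (-w) (by rw [norm_neg]; exact hw1.le))
    rw [← enorm_neg, map_neg, neg_add, sub_eq_add_neg]
    congr 4; funext i; simp [hw, hL]
  refine ⟨w, U.smul_mem _ u.2, hw1, ?_⟩
  have h3 : (2 : ℝ≥0∞) * ‖P.app w‖ₑ ≤ 2 * A.error := by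
    calc (2 : ℝ≥0∞) * ‖P.app w‖ₑ = ‖(2 : 𝕜) • P.app w‖ₑ := by
          rw [enorm_smul]; congr 1
          rw [← ofReal_norm, RCLike.norm_ofNat]; simp
      _ = ‖(P.app w - A.φ 0) + (P.app w + A.φ 0)‖ₑ := by
          congr 1; rw [two_smul]; abel
      _ ≤ 2 * A.error := by
          rw [two_mul]; exact (enorm_add_le _ _).trans (add_le_add h1 h2)
  exact (ENNReal.mul_le_mul_iff_right (by simp) (by simp)).1 h3

theorem exists_submodule_of_eWor_le [CompleteSpace F] (P : Problem W 𝕜 F) {n : ℕ} (hn : n ≠ 0)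
    {t : ℝ} (ht : 0 ≤ t) (h : eWor P n ≤ ENNReal.ofReal t) :
    ∃ V : Submodule 𝕜 (W.G 𝕜), FiniteDimensional 𝕜 V ∧ Module.finrank 𝕜 V ≤ n ∧
      ∀ f, ∃ v ∈ V, ‖P.app f - v‖ ≤ t * ‖f‖ := by
  refine exists_submodule_forall_norm_sub_le P.app P.isCompactOperator_app ht fun U hU => ?_
  obtain ⟨u₀, hu₀, hu₀1, hmin⟩ := exists_isMin_norm_apply P.app U hU
  refine ⟨u₀, hu₀, fun h0 => by simp [h0] at hu₀1, ?_⟩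
  rw [hu₀1, mul_one]
  by_contra! hlt
  have h2 : eWor P n < ENNReal.ofReal ‖P.app u₀‖ :=
    h.trans_lt ((ENNReal.ofReal_lt_ofReal_iff_of_nonneg ht).2 hlt)
  rw [eWor, if_neg hn, iInf_lt_iff] at h2
  obtain ⟨A, hA⟩ := h2
  obtain ⟨u, hu, hu1, hle⟩ := A.exists_enorm_le_error U hU
  have h3 : ‖P.app u₀‖ ≤ ‖P.app u‖ := hmin u hu hu1
  have h4 := hle.trans_lt hA
  rw [← ofReal_norm] at h4
  exact absurd h4 (not_lt.2 (ENNReal.ofReal_le_ofReal h3))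

theorem exists_eWor_le (P : Problem W 𝕜 F) {t : ℝ} (ht : 0 < t) :
    ∃ n, eWor P n ≤ ENNReal.ofReal t := by
  obtain ⟨V, hV, h⟩ := exists_finiteDimensional_forall_norm_sub_le P.app
    P.isCompactOperator_app ht
  obtain ⟨φ, -, hφ⟩ := exists_orthonormal_norm_sub_le V
  refine ⟨Module.finrank 𝕜 V + 1, ?_⟩
  rw [eWor, if_neg (Nat.succ_ne_zero _)]
  refine iInf_le_of_le
    -- The extra zero functional, ignored by φ, keeps the number of functionals positive when V = 0,
    -- as `eWor` has a separate convention at 0.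
    { L := Fin.snoc (fun j => (innerSL 𝕜 (φ j)).toLinearMap ∘ₗ P.app.toLinearMap) 0
      φ := fun y => ∑ j, y (Fin.castSucc j) • φ j
      stronglyMeasurable_φ :=
        (continuous_finsetSum _ fun j _ => by fun_prop).stronglyMeasurable } ?_
  refine iSup₂_le fun f hf => ?_
  obtain ⟨v, hv, hle⟩ := h f hf
  rw [← ofReal_norm]
  refine ENNReal.ofReal_le_ofReal (le_trans ?_ hle)
  simpa using hφ (P.app f) v hv

end Worst

/-! ### Second moments of determinants and of empirical means -/

section Moments

variable {X 𝕜 : Type*} [MeasurableSpace X] [RCLike 𝕜]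

theorem lintegral_enorm_sq_eq {μ : Measure X} {h : X → 𝕜}
    (hint : Integrable (fun x => h x * (starRingEnd 𝕜) (h x)) μ) :
    ∫⁻ x, ‖h x‖ₑ ^ 2 ∂μ = ENNReal.ofReal (RCLike.re (∫ x, h x * (starRingEnd 𝕜) (h x) ∂μ)) := by
  have hre := hint.re
  simp only [RCLike.mul_conj, ← RCLike.ofReal_pow, RCLike.ofReal_re] at hre
  simp only [RCLike.mul_conj, ← RCLike.ofReal_pow]
  rw [integral_ofReal, RCLike.ofReal_re,
    ofReal_integral_eq_lintegral_ofReal hre (Filter.Eventually.of_forall fun x => by positivity)]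
  refine lintegral_congr fun x => ?_
  rw [ENNReal.ofReal_pow (norm_nonneg _), ofReal_norm]

theorem lintegral_enorm_sq_lp {μ : Measure X} (f : Lp 𝕜 2 μ) :
    ∫⁻ x, ‖f x‖ₑ ^ 2 ∂μ = ‖f‖ₑ ^ 2 := by
  rw [Lp.enorm_def, eLpNorm_eq_lintegral_rpow_enorm_toReal (by simp) (by simp)]
  simp only [ENNReal.toReal_ofNat, ENNReal.rpow_ofNat, one_div]
  rw [← ENNReal.rpow_natCast, ← ENNReal.rpow_mul]
  simp

/-- Andréief's identity for orthogonal functions. -/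
theorem lintegral_enorm_det_sq {ι : Type*} [Fintype ι] [DecidableEq ι] {μ : Measure X}
    [IsProbabilityMeasure μ] (f : ι → Lp 𝕜 2 μ)
    (hf : Pairwise fun i j => inner 𝕜 (f i) (f j) = 0) :
    ∫⁻ x : ι → X, ‖(Matrix.of fun i j => f i (x j)).det‖ₑ ^ 2 ∂(Measure.pi fun _ => μ) =
      (Fintype.card ι).factorial * ∏ i, ‖f i‖ₑ ^ 2 := by
  have hexp : ∀ x : ι → X, (Matrix.of fun i j => f i (x j)).det *
      (starRingEnd 𝕜) (Matrix.of fun i j => f i (x j)).det =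
      ∑ σ : Equiv.Perm ι, ∑ τ : Equiv.Perm ι, (((σ.sign : ℤ) : 𝕜) * ((τ.sign : ℤ) : 𝕜)) *
        ∏ i, inner 𝕜 (f (τ i) (x i)) (f (σ i) (x i)) := by
    intro x
    simp only [Matrix.det_apply', map_sum, map_mul, map_prod, Finset.sum_mul_sum, Matrix.of_apply,
      RCLike.inner_apply, Finset.prod_mul_distrib, map_intCast]
    refine Finset.sum_congr rfl fun σ _ => Finset.sum_congr rfl fun τ _ => ?_
    ring
  have hi : ∀ σ τ : Equiv.Perm ι, Integrable (fun x : ι → X =>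
      (((σ.sign : ℤ) : 𝕜) * ((τ.sign : ℤ) : 𝕜)) *
        ∏ i, inner 𝕜 (f (τ i) (x i)) (f (σ i) (x i))) (Measure.pi fun _ => μ) := fun σ τ =>
    (Integrable.fintype_prod (f := fun i y => inner 𝕜 (f (τ i) y) (f (σ i) y)) fun i =>
      L2.integrable_inner (f (τ i)) (f (σ i))).const_mul _
  -- Fubini turns each term into a product of inner products. For τ ≠ σ one factor vanishes by
  -- orthogonality; for τ = σ the signs cancel.
  have hval : ∀ σ τ : Equiv.Perm ι, ∫ x : ι → X, (((σ.sign : ℤ) : 𝕜) * ((τ.sign : ℤ) : 𝕜)) *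
        ∏ i, inner 𝕜 (f (τ i) (x i)) (f (σ i) (x i)) ∂(Measure.pi fun _ => μ) =
      if τ = σ then ((∏ i, ‖f i‖ ^ 2 : ℝ) : 𝕜) else 0 := by
    intro σ τ
    rw [integral_const_mul,
      integral_fintype_prod_eq_prod (fun i y => inner 𝕜 (f (τ i) y) (f (σ i) y))]
    simp only [← L2.inner_def]
    split_ifs with h
    · subst h
      rw [← Int.cast_mul, Int.units_coe_mul_self, Int.cast_one, one_mul,
        Equiv.prod_comp τ fun i => inner 𝕜 (f i) (f i)]
      simp [inner_self_eq_norm_sq_to_K]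
    · obtain ⟨i, hi⟩ : ∃ i, τ i ≠ σ i := by
        by_contra! hc
        exact h (Equiv.ext hc)
      rw [Finset.prod_eq_zero (Finset.mem_univ i) (hf hi), mul_zero]
  rw [lintegral_enorm_sq_eq]
  · simp only [hexp]
    rw [integral_finsetSum _ fun σ _ => integrable_finsetSum _ fun τ _ => hi σ τ]
    simp_rw [integral_finsetSum Finset.univ fun τ _ => hi _ τ, hval]
    simp only [Finset.sum_ite_eq', Finset.mem_univ, if_true, Finset.sum_const, Finset.card_univ,
      Fintype.card_perm, nsmul_eq_mul]
    rw [← RCLike.ofReal_natCast, ← RCLike.ofReal_mul, RCLike.ofReal_re,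
      ENNReal.ofReal_mul (by positivity), ENNReal.ofReal_natCast,
      ENNReal.ofReal_prod_of_nonneg fun i _ => by positivity]
    simp only [ENNReal.ofReal_pow (norm_nonneg _), ofReal_norm]
  · simp only [hexp]
    exact integrable_finsetSum _ fun σ _ => integrable_finsetSum _ fun τ _ => hi σ τ

/-- The second moment of a sum of independent centred random variables. -/
theorem lintegral_enorm_sum_sq {ι : Type*} [Fintype ι] {ν : Measure X} [IsProbabilityMeasure ν]
    {Y : X → 𝕜} (hY : MemLp Y 2 ν) (h0 : ∫ x, Y x ∂ν = 0) :
    ∫⁻ x : ι → X, ‖∑ i, Y (x i)‖ₑ ^ 2 ∂(Measure.pi fun _ => ν) =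
      Fintype.card ι * ∫⁻ x, ‖Y x‖ₑ ^ 2 ∂ν := by
  classical
  have hmp := fun i : ι => measurePreserving_eval (fun _ : ι => ν) i
  have hL : ∀ i : ι, MemLp (fun x : ι → X => Y (x i)) 2 (Measure.pi fun _ => ν) := fun i =>
    hY.comp_measurePreserving (hmp i)
  have hLc : ∀ i : ι, MemLp (fun x : ι → X => (starRingEnd 𝕜) (Y (x i))) 2
      (Measure.pi fun _ => ν) := fun i => (hL i).star
  have hi : ∀ i j : ι, Integrable (fun x : ι → X => Y (x i) * (starRingEnd 𝕜) (Y (x j)))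
      (Measure.pi fun _ => ν) := fun i j => (hL i).integrable_mul (hLc j)
  have hYY : Integrable (fun x => Y x * (starRingEnd 𝕜) (Y x)) ν := hY.integrable_mul hY.star
  have hexp : ∀ x : ι → X, (∑ i, Y (x i)) * (starRingEnd 𝕜) (∑ i, Y (x i)) =
      ∑ i, ∑ j, Y (x i) * (starRingEnd 𝕜) (Y (x j)) := fun x => by
    rw [map_sum, Finset.sum_mul_sum]
  have hval : ∀ i j : ι, ∫ x : ι → X, Y (x i) * (starRingEnd 𝕜) (Y (x j))
      ∂(Measure.pi fun _ => ν) = if j = i then ∫ x, Y x * (starRingEnd 𝕜) (Y x) ∂ν else 0 := by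
    intro i j
    split_ifs with h
    · subst h
      have := integral_map (hmp j).measurable.aemeasurable
        (f := fun x => Y x * (starRingEnd 𝕜) (Y x))
        ((hmp j).map_eq.symm ▸ hYY.aestronglyMeasurable)
      rw [(hmp j).map_eq] at this
      exact this.symm
    · have hind : ProbabilityTheory.IndepFun (fun x : ι → X => Y (x i))
          (fun x : ι → X => (starRingEnd 𝕜) (Y (x j))) (Measure.pi fun _ => ν) :=
        ((ProbabilityTheory.iIndepFun_pi (μ := fun _ : ι => ν) (X := fun _ => Y)
          fun _ => hY.aestronglyMeasurable.aemeasurable).indepFun (Ne.symm h)).comp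
          (φ := id) (ψ := starRingEnd 𝕜) measurable_id RCLike.continuous_conj.measurable
      have := hind.integral_mul_eq_mul_integral (hL i).1 (hLc j).1
      simp only [Pi.mul_apply] at this
      rw [this, ← integral_map (hmp i).measurable.aemeasurable (f := Y)
        ((hmp i).map_eq.symm ▸ hY.1), (hmp i).map_eq, h0, zero_mul]
  rw [lintegral_enorm_sq_eq, lintegral_enorm_sq_eq hYY]
  · simp only [hexp]
    rw [integral_finsetSum _ fun i _ => integrable_finsetSum _ fun j _ => hi i j]
    simp_rw [integral_finsetSum Finset.univ fun j _ => hi _ j, hval]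
    simp only [Finset.sum_ite_eq', Finset.mem_univ, if_true, Finset.sum_const, Finset.card_univ,
      nsmul_eq_mul]
    rw [← RCLike.ofReal_natCast, RCLike.re_ofReal_mul,
      ENNReal.ofReal_mul (by positivity), ENNReal.ofReal_natCast]
  · simp only [hexp]
    exact integrable_finsetSum _ fun i _ => integrable_finsetSum _ fun j _ => hi i j

theorem lintegral_enorm_sub_integral_sq_le {ν : Measure X} [IsProbabilityMeasure ν]
    {Z : X → 𝕜} (hZ : MemLp Z 2 ν) :
    ∫⁻ x, ‖Z x - ∫ y, Z y ∂ν‖ₑ ^ 2 ∂ν ≤ ∫⁻ x, ‖Z x‖ₑ ^ 2 ∂ν := by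
  set z := ∫ y, Z y ∂ν with hz
  have hZ1 : Integrable Z ν := hZ.integrable (by norm_num)
  have hZc : Integrable (fun x => (starRingEnd 𝕜) (Z x)) ν :=
    (hZ.star).integrable (by norm_num)
  have hZZ : Integrable (fun x => Z x * (starRingEnd 𝕜) (Z x)) ν := hZ.integrable_mul hZ.star
  have hexp : (fun x => (Z x - z) * (starRingEnd 𝕜) (Z x - z)) = fun x =>
      Z x * (starRingEnd 𝕜) (Z x) - Z x * (starRingEnd 𝕜) z - z * (starRingEnd 𝕜) (Z x)
        + z * (starRingEnd 𝕜) z := by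
    funext x; rw [map_sub]; ring
  have h1 := hZ1.mul_const ((starRingEnd 𝕜) z)
  have h2 := hZc.const_mul z
  have h3 : Integrable (fun x => Z x * (starRingEnd 𝕜) (Z x) - Z x * (starRingEnd 𝕜) z) ν :=
    hZZ.sub h1
  have h4 : Integrable (fun x => Z x * (starRingEnd 𝕜) (Z x) - Z x * (starRingEnd 𝕜) z -
    z * (starRingEnd 𝕜) (Z x)) ν := h3.sub h2
  rw [lintegral_enorm_sq_eq hZZ, lintegral_enorm_sq_eq]
  · refine ENNReal.ofReal_le_ofReal ?_
    rw [hexp, integral_add h4 (integrable_const _),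
      integral_sub h3 h2, integral_sub hZZ h1, integral_mul_const, integral_const_mul,
      integral_conj, ← hz]
    simp only [integral_const, probReal_univ, one_smul, sub_add_cancel, map_sub]
    rw [RCLike.mul_conj, ← RCLike.ofReal_pow, RCLike.ofReal_re]
    have := sq_nonneg ‖z‖
    linarith
  · rw [hexp]
    exact h4.add (integrable_const _)

/-- The mean square error of the empirical mean. -/
theorem lintegral_enorm_mean_sub_integral_sq_le {ι : Type*} [Fintype ι] [Nonempty ι]
    {ν : Measure X} [IsProbabilityMeasure ν] {Z : X → 𝕜} (hZ : MemLp Z 2 ν) :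
    ∫⁻ x : ι → X, ‖(Fintype.card ι : 𝕜)⁻¹ * ∑ i, Z (x i) - ∫ y, Z y ∂ν‖ₑ ^ 2
        ∂(Measure.pi fun _ => ν) ≤
      (Fintype.card ι : ℝ≥0∞)⁻¹ * ∫⁻ x, ‖Z x‖ₑ ^ 2 ∂ν := by
  set z := ∫ y, Z y ∂ν with hz
  have hc : (Fintype.card ι : 𝕜) ≠ 0 := by simp
  have hc' : (Fintype.card ι : ℝ≥0∞) ≠ 0 := by simp
  have hpt : ∀ x : ι → X, ‖(Fintype.card ι : 𝕜)⁻¹ * ∑ i, Z (x i) - z‖ₑ ^ 2 =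
      ((Fintype.card ι : ℝ≥0∞)⁻¹) ^ 2 * ‖∑ i, (Z (x i) - z)‖ₑ ^ 2 := by
    intro x
    rw [← mul_pow]
    congr 1
    have h1 : ‖(Fintype.card ι : 𝕜)⁻¹‖ₑ = (Fintype.card ι : ℝ≥0∞)⁻¹ := by
      rw [enorm_inv hc, ← ofReal_norm, RCLike.norm_natCast, ENNReal.ofReal_natCast]
    rw [← h1, ← enorm_mul, Finset.sum_sub_distrib, Finset.sum_const, Finset.card_univ,
      nsmul_eq_mul, mul_sub, inv_mul_cancel_left₀ hc]
  simp only [hpt]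
  rw [lintegral_const_mul' _ _ (by simp), lintegral_enorm_sum_sq (Y := fun x => Z x - z)
    (hZ.sub (memLp_const z)),
    ← mul_assoc, sq, mul_assoc (_⁻¹), ENNReal.inv_mul_cancel hc' (by simp), mul_one]
  · exact mul_le_mul' le_rfl (lintegral_enorm_sub_integral_sq_le hZ)
  · have hZ1 : Integrable Z ν := hZ.integrable (by norm_num)
    rw [integral_sub hZ1 (integrable_const _), ← hz]
    simp

end Moments

/-! ### Importance sampling with the Christoffel density -/

section Density

variable {X 𝕜 : Type*} [MeasurableSpace X] [RCLike 𝕜] {μ : Measure X} {m : ℕ}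

/-- The normalized Christoffel function `m⁻¹ ∑ |φ_j|²` of a finite system in `L₂`. -/
def christoffel (φ : Fin m → Lp 𝕜 2 μ) (x : X) : ℝ≥0 :=
  (m : ℝ≥0)⁻¹ * ∑ j, ‖φ j x‖₊ ^ 2

theorem measurable_christoffel (φ : Fin m → Lp 𝕜 2 μ) : Measurable (christoffel φ) := by
  have := fun j => (Lp.stronglyMeasurable (φ j)).measurable
  unfold christoffel
  fun_prop

/-- The measure with density `christoffel φ`. -/
def christoffelMeasure (φ : Fin m → Lp 𝕜 2 μ) : Measure X :=
  μ.withDensity fun x => (christoffel φ x : ℝ≥0∞)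

/-- The weighted products whose means are the coefficients `⟨φ_j, r⟩`. -/
def weightedProd (φ : Fin m → Lp 𝕜 2 μ) (r : X → 𝕜) (j : Fin m) (x : X) : 𝕜 :=
  r x * (starRingEnd 𝕜) (φ j x) * (((christoffel φ x : ℝ)⁻¹ : ℝ) : 𝕜)

theorem isProbabilityMeasure_christoffelMeasure {φ : Fin m → Lp 𝕜 2 μ} (hφ : Orthonormal 𝕜 φ)
    (hm : m ≠ 0) : IsProbabilityMeasure (christoffelMeasure φ) := by
  constructor
  have := fun j => (Lp.stronglyMeasurable (φ j)).measurable
  have hm' : (m : ℝ≥0) ≠ 0 := by simpa using hm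
  rw [christoffelMeasure, withDensity_apply _ MeasurableSet.univ, Measure.restrict_univ]
  simp only [christoffel, ENNReal.coe_mul, ENNReal.ofNNReal_finsetSum, ENNReal.coe_pow]
  rw [lintegral_const_mul _ (by fun_prop), lintegral_finsetSum _ fun j _ => by fun_prop]
  have h1 : ∀ j, ∫⁻ x, (‖φ j x‖₊ : ℝ≥0∞) ^ 2 ∂μ = 1 := fun j => by
    rw [show ∫⁻ x, (‖φ j x‖₊ : ℝ≥0∞) ^ 2 ∂μ = ‖φ j‖ₑ ^ 2 from lintegral_enorm_sq_lp (φ j),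
      ← ofReal_norm, hφ.1 j]
    simp
  simp only [h1, Finset.sum_const, Finset.card_univ, Fintype.card_fin, nsmul_eq_mul, mul_one]
  rw [ENNReal.coe_inv hm']
  exact ENNReal.inv_mul_cancel (by simpa using hm) (by simp)

/-- Where the density vanishes all φ_j vanish too, so the convention 0⁻¹ = 0 loses nothing. -/
theorem christoffel_smul_weightedProd (φ : Fin m → Lp 𝕜 2 μ) (hm : m ≠ 0) (r : X → 𝕜)
    (j : Fin m) (x : X) :
    christoffel φ x • weightedProd φ r j x = r x * (starRingEnd 𝕜) (φ j x) := by
  rw [weightedProd, NNReal.smul_def, RCLike.real_smul_eq_coe_mul]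
  by_cases h : christoffel φ x = 0
  · have h1 : φ j x = 0 := by
      have := h
      rw [christoffel, mul_eq_zero, or_iff_right (by simpa using hm),
        Finset.sum_eq_zero_iff] at this
      simpa using this j (Finset.mem_univ j)
    simp [h1]
  · have h2 : ((christoffel φ x : ℝ) : 𝕜) ≠ 0 := by simpa using h
    push_cast
    field_simp

/-- This is why the Christoffel density is chosen: Σ|φ_j|² divided by the density is the constant m
off the zero set, so the total second moment is controlled by ‖r‖² without any bound on sup |φ_j|.
-/
theorem christoffel_mul_sum_weightedProd_le (φ : Fin m → Lp 𝕜 2 μ) (hm : m ≠ 0) (r : X → 𝕜)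
    (x : X) :
    (christoffel φ x : ℝ≥0∞) * ∑ j, ‖weightedProd φ r j x‖ₑ ^ 2 ≤ m * ‖r x‖ₑ ^ 2 := by
  have hm' : (m : ℝ≥0) ≠ 0 := by simpa using hm
  simp only [enorm_eq_nnnorm]
  norm_cast
  have h1 : ∑ j, ‖φ j x‖₊ ^ 2 = m * christoffel φ x := by
    rw [christoffel, mul_inv_cancel_left₀ hm']
  have h2 : ∀ j, ‖weightedProd φ r j x‖₊ ^ 2 =
      ‖r x‖₊ ^ 2 * (christoffel φ x)⁻¹ ^ 2 * ‖φ j x‖₊ ^ 2 := fun j => by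
    rw [weightedProd, nnnorm_mul, nnnorm_mul, RCLike.nnnorm_conj]
    have : ‖(((christoffel φ x : ℝ)⁻¹ : ℝ) : 𝕜)‖₊ = (christoffel φ x)⁻¹ := by
      ext; simp
    rw [this]; ring
  simp only [h2]
  rw [← Finset.mul_sum, h1]
  by_cases h : christoffel φ x = 0
  · simp [h]
  · refine le_of_eq ?_
    field_simp

theorem aestronglyMeasurable_weightedProd (φ : Fin m → Lp 𝕜 2 μ) (r : Lp 𝕜 2 μ) (j : Fin m)
    (ν : Measure X) : AEStronglyMeasurable (weightedProd φ r j) ν := by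
  have h1 := (Lp.stronglyMeasurable r).measurable
  have h2 := (Lp.stronglyMeasurable (φ j)).measurable
  have h3 := measurable_christoffel φ
  have h4 := (RCLike.continuous_conj (K := 𝕜)).measurable.comp h2
  have h5 := (RCLike.continuous_ofReal (K := 𝕜)).measurable.comp
    (h3.coe_nnreal_real.inv)
  exact ((h1.mul h4).mul h5).aestronglyMeasurable

theorem sum_lintegral_weightedProd_le (φ : Fin m → Lp 𝕜 2 μ) (hm : m ≠ 0) (r : Lp 𝕜 2 μ) :
    ∑ j, ∫⁻ x, ‖weightedProd φ r j x‖ₑ ^ 2 ∂(christoffelMeasure φ) ≤ m * ‖r‖ₑ ^ 2 := by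
  have hZ := fun j (ν : Measure X) => aestronglyMeasurable_weightedProd φ r j ν
  rw [← lintegral_finsetSum' _ fun j _ => (hZ j _).enorm.pow_const 2, christoffelMeasure,
    lintegral_withDensity_eq_lintegral_mul₀ (measurable_christoffel φ).coe_nnreal_ennreal.aemeasurable
      (Finset.aemeasurable_fun_sum _ fun j _ => (hZ j _).enorm.pow_const 2)]
  refine (lintegral_mono fun x => christoffel_mul_sum_weightedProd_le φ hm r x).trans ?_
  rw [lintegral_const_mul' _ _ (by simp), lintegral_enorm_sq_lp]

theorem memLp_weightedProd (φ : Fin m → Lp 𝕜 2 μ) (hm : m ≠ 0) (r : Lp 𝕜 2 μ) (j : Fin m) :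
    MemLp (weightedProd φ r j) 2 (christoffelMeasure φ) := by
  refine ⟨aestronglyMeasurable_weightedProd φ r j _, ?_⟩
  rw [eLpNorm_lt_top_iff_lintegral_rpow_enorm_lt_top (by simp) (by simp)]
  simp only [ENNReal.toReal_ofNat, ENNReal.rpow_ofNat]
  refine ((Finset.single_le_sum (f := fun j =>
    ∫⁻ x, ‖weightedProd φ r j x‖ₑ ^ 2 ∂(christoffelMeasure φ)) (fun _ _ => zero_le)
    (Finset.mem_univ j)).trans (sum_lintegral_weightedProd_le φ hm r)).trans_lt ?_
  exact ENNReal.mul_lt_top (by simp) (ENNReal.pow_lt_top (by simp))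

theorem integral_weightedProd (φ : Fin m → Lp 𝕜 2 μ) (hm : m ≠ 0) (r : Lp 𝕜 2 μ) (j : Fin m) :
    ∫ x, weightedProd φ r j x ∂(christoffelMeasure φ) = inner 𝕜 (φ j) r := by
  rw [christoffelMeasure, integral_withDensity_eq_integral_smul (measurable_christoffel φ)]
  simp only [christoffel_smul_weightedProd φ hm]
  rw [L2.inner_def]
  simp only [RCLike.inner_apply]

end Density

/-! ### Coefficient estimation by determinantal interpolation -/

section Estimable

variable {X : Type} {𝕜 : Type*} [MeasurableSpace X] [RCLike 𝕜] {μ : Measure X} {m : ℕ}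

/-- The coefficients `⟨φ_j, f⟩` can be estimated from random samples of `f`, indexed by `ι`, with
mean square error at most `C` times the squared distance of `f` from the span of `φ`. -/
def CoeffEstimable (φ : Fin m → Lp 𝕜 2 μ) (ι : Type) (C : ℝ≥0∞) : Prop :=
  ∃ (Ω : Type) (_ : MeasurableSpace Ω) (ℙ : Measure Ω) (_ : IsProbabilityMeasure ℙ)
    (pt : ι → Ω → X) (coef : Ω → (ι → 𝕜) → Fin m → 𝕜),
    (∀ i, Measure.QuasiMeasurePreserving (pt i) ℙ μ) ∧
    Measurable (Function.uncurry coef) ∧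
    ∀ f : Lp 𝕜 2 μ, ∫⁻ ω, ∑ j, ‖coef ω (fun i => f (pt i ω)) j - inner 𝕜 (φ j) f‖ₑ ^ 2 ∂ℙ ≤
      C * ‖f - ∑ j, inner 𝕜 (φ j) f • φ j‖ₑ ^ 2

theorem lp_coeFn_sub_sum (φ : Fin m → Lp 𝕜 2 μ) (f : Lp 𝕜 2 μ) (c : Fin m → 𝕜) :
    ((f - ∑ l, c l • φ l : Lp 𝕜 2 μ) : X → 𝕜) =ᵐ[μ] fun x => f x - ∑ l, c l * φ l x := by
  have h : ((∑ l, c l • φ l : Lp 𝕜 2 μ) : X → 𝕜) =ᵐ[μ] fun x => ∑ l, c l * φ l x := by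
    have h1 : ∀ᵐ x ∂μ, ∀ l, (c l • φ l : Lp 𝕜 2 μ) x = c l * φ l x :=
      ae_all_iff.2 fun l => by
        filter_upwards [Lp.coeFn_smul (c l) (φ l)] with x hx
        simpa using hx
    filter_upwards [h1, Lp.coeFn_finsetSum Finset.univ fun l => c l • φ l] with x hx hs
    rw [hs]
    simp [hx]
  filter_upwards [h, Lp.coeFn_sub f (∑ l, c l • φ l)] with x h1 h2
  rw [h2, Pi.sub_apply, h1]

theorem inner_sub_sum {φ : Fin m → Lp 𝕜 2 μ} (hφ : Orthonormal 𝕜 φ) (f : Lp 𝕜 2 μ)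
    (c : Fin m → 𝕜) (j : Fin m) :
    inner 𝕜 (φ j) (f - ∑ l, c l • φ l) = inner 𝕜 (φ j) f - c j := by
  rw [inner_sub_right, hφ.inner_right_fintype]

/-- Pythagoras. It gives the size of the residual in a refinement step and also the final error of
the algorithm. -/
theorem enorm_sub_sum_sq {φ : Fin m → Lp 𝕜 2 μ} (hφ : Orthonormal 𝕜 φ) (f : Lp 𝕜 2 μ)
    (c : Fin m → 𝕜) :
    ‖f - ∑ l, c l • φ l‖ₑ ^ 2 = ‖f - ∑ l, inner 𝕜 (φ l) f • φ l‖ₑ ^ 2 +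
      ∑ l, ‖c l - inner 𝕜 (φ l) f‖ₑ ^ 2 := by
  set g := f - ∑ l, inner 𝕜 (φ l) f • φ l with hg
  have h1 : f - ∑ l, c l • φ l = g - ∑ l, (c l - inner 𝕜 (φ l) f) • φ l := by
    simp only [hg, sub_smul, Finset.sum_sub_distrib]; abel
  have h2 : inner 𝕜 g (∑ l, (c l - inner 𝕜 (φ l) f) • φ l) = 0 := by
    rw [inner_sum]
    refine Finset.sum_eq_zero fun l _ => ?_
    rw [inner_smul_right, ← inner_conj_symm g (φ l), hg, inner_sub_sum hφ]
    simp
  have h3 : ‖f - ∑ l, c l • φ l‖ ^ 2 = ‖g‖ ^ 2 + ∑ l, ‖c l - inner 𝕜 (φ l) f‖ ^ 2 := by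
    rw [h1, @norm_sub_sq 𝕜, h2]
    congr 1
    · simp
    · rw [@norm_sq_eq_re_inner 𝕜, hφ.inner_sum, map_sum]
      refine Finset.sum_congr rfl fun l _ => ?_
      rw [RCLike.conj_mul, ← RCLike.ofReal_pow, RCLike.ofReal_re]
  simp only [← ofReal_norm]
  simp only [← ENNReal.ofReal_pow (norm_nonneg _)]
  rw [h3, ENNReal.ofReal_add (by positivity) (by positivity),
    ENNReal.ofReal_sum_of_nonneg fun _ _ => by positivity]

theorem measurable_det {Y ι : Type*} [MeasurableSpace Y] [Fintype ι] [DecidableEq ι]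
    {M : Y → Matrix ι ι 𝕜} (hM : ∀ i j, Measurable fun y => M y i j) :
    Measurable fun y => (M y).det := by
  simp only [Matrix.det_apply']
  exact Finset.measurable_fun_sum _ fun σ _ =>
    (Finset.measurable_fun_prod _ fun i _ => hM _ _).const_mul _

open Matrix in
-- Cramer's rule with a perturbation g of the data: after division by det M, the error of the j-th
-- interpolation coefficient is a ratio of determinants.
theorem det_updateRow_sum_add {ι : Type*} [Fintype ι] [DecidableEq ι] (M : Matrix ι ι 𝕜)
    (c g : ι → 𝕜) (j : ι) :
    (M.updateRow j fun k => ∑ l, c l * M l k + g k).det = c j * M.det + (M.updateRow j g).det := by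
  have h : (fun k => ∑ l, c l * M l k + g k) = Mᵀ *ᵥ c + g := by
    funext k
    simp [Matrix.mulVec, dotProduct, mul_comm]
  rw [h, ← cramer_transpose_apply, ← cramer_transpose_apply, map_add, Pi.add_apply,
    cramer_eq_adjugate_mulVec, mulVec_mulVec, adjugate_mul, smul_mulVec, one_mulVec, det_transpose,
    Pi.smul_apply, smul_eq_mul, mul_comm]

/-- Interpolation at the points of the projection determinantal point process. -/
theorem coeffEstimable_fin [IsProbabilityMeasure μ] {φ : Fin m → Lp 𝕜 2 μ}
    (hφ : Orthonormal 𝕜 φ) : CoeffEstimable φ (Fin m) m := by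
  set M : (Fin m → X) → Matrix (Fin m) (Fin m) 𝕜 := fun x => Matrix.of fun i j => φ i (x j) with hM
  have hφm := fun j => (Lp.stronglyMeasurable (φ j)).measurable
  have hMm : ∀ i j, Measurable fun x => M x i j := fun i j =>
    (hφm i).comp (measurable_pi_apply j)
  have hD : Measurable fun x => (M x).det := measurable_det hMm
  have hfac : ((m.factorial : ℕ) : ℝ≥0∞) ≠ 0 := by simp [Nat.factorial_ne_zero]
  set w : (Fin m → X) → ℝ≥0∞ := fun x => (m.factorial : ℝ≥0∞)⁻¹ * ‖(M x).det‖ₑ ^ 2 with hw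
  have hwm : Measurable w := (hD.enorm.pow_const 2).const_mul _
  refine ⟨Fin m → X, inferInstance, (Measure.pi fun _ => μ).withDensity w, ⟨?_⟩, fun i x => x i,
    fun x y j => ((M x).updateRow j y).det / (M x).det, fun i => ?_, ?_, fun f => ?_⟩
  · rw [withDensity_apply _ MeasurableSet.univ, Measure.restrict_univ, hw,
      lintegral_const_mul _ (hD.enorm.pow_const 2), lintegral_enorm_det_sq φ hφ.2]
    have h1 : ∀ i, ‖φ i‖ₑ = 1 := fun i => by rw [← ofReal_norm, hφ.1 i, ENNReal.ofReal_one]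
    simp only [h1, one_pow, Finset.prod_const_one, mul_one, Fintype.card_fin]
    exact ENNReal.inv_mul_cancel hfac (by simp)
  · exact (Measure.quasiMeasurePreserving_eval (fun _ => μ) i).mono_left
      (withDensity_absolutelyContinuous _ _)
  · refine measurable_pi_lambda _ fun j => Measurable.div (measurable_det fun i k => ?_)
      (hD.comp measurable_fst)
    by_cases h : i = j
    · subst h
      simp only [Matrix.updateRow_self]
      exact (measurable_pi_apply k).comp measurable_snd
    · simp only [Matrix.updateRow_ne h]
      exact (hMm i k).comp measurable_fst
  · set g := f - ∑ j, inner 𝕜 (φ j) f • φ j with hg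
    have hfm := (Lp.stronglyMeasurable f).measurable
    have hae : ∀ᵐ x ∂(Measure.pi fun _ : Fin m => μ), ∀ k,
        f (x k) = ∑ l, inner 𝕜 (φ l) f * φ l (x k) + g (x k) := by
      refine ae_all_iff.2 fun k => ?_
      filter_upwards [(Measure.quasiMeasurePreserving_eval (fun _ => μ) k).ae_eq_comp
        (lp_coeFn_sub_sum φ f fun l => inner 𝕜 (φ l) f)] with x hx
      simp only [Function.comp, Function.eval] at hx
      rw [hg, hx]; ring
    have hmeas : Measurable fun x : Fin m → X => ∑ j,
        ‖((M x).updateRow j fun i => f (x i)).det / (M x).det - inner 𝕜 (φ j) f‖ₑ ^ 2 := by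
      refine Finset.measurable_fun_sum _ fun j _ => Measurable.pow_const (Measurable.enorm
        (((measurable_det fun i k => ?_).div hD).sub_const _)) 2
      by_cases h : i = j
      · subst h
        simp only [Matrix.updateRow_self]
        exact hfm.comp (measurable_pi_apply k)
      · simp only [Matrix.updateRow_ne h]
        exact hMm i k
    rw [lintegral_withDensity_eq_lintegral_mul _ hwm hmeas]
    have hG : ∀ j (x : Fin m → X), (M x).updateRow j (fun k => g (x k)) =
        Matrix.of fun i k => Function.update φ j g i (x k) := fun j x => by
      ext i k
      by_cases h : i = j
      · subst h; simp
      · simp [h, hM]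
    calc ∫⁻ x, (w * fun x : Fin m → X => ∑ j,
          ‖((M x).updateRow j fun i => f (x i)).det / (M x).det - inner 𝕜 (φ j) f‖ₑ ^ 2) x
          ∂(Measure.pi fun _ => μ)
        ≤ ∫⁻ x, (m.factorial : ℝ≥0∞)⁻¹ * ∑ j,
          ‖(Matrix.of fun i k => Function.update φ j g i (x k)).det‖ₑ ^ 2
          ∂(Measure.pi fun _ => μ) := by
          refine lintegral_mono_ae ?_
          filter_upwards [hae] with x hx
          simp only [Pi.mul_apply, hw]
          rw [mul_assoc]
          gcongr
          rw [Finset.mul_sum]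
          gcongr with j
          rw [← mul_pow, ← enorm_mul]
          -- Interpolation breaks down only where the density is zero; dropping this set is what
          -- makes the estimate an inequality.
          by_cases h0 : (M x).det = 0
          · simp [h0]
          · have h1 : (fun i => f (x i)) = fun k => ∑ l, inner 𝕜 (φ l) f * M x l k + g (x k) :=
              funext hx
            rw [h1, det_updateRow_sum_add, hG]
            refine le_of_eq ?_
            congr 2
            field_simp
            ring
      _ = (m.factorial : ℝ≥0∞)⁻¹ * ∑ j : Fin m, (m.factorial : ℝ≥0∞) * ‖g‖ₑ ^ 2 := by
          rw [lintegral_const_mul' _ _ (by simpa using hfac), lintegral_finsetSum]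
          · congr 1
            refine Finset.sum_congr rfl fun j _ => ?_
            rw [lintegral_enorm_det_sq]
            · rw [Fintype.card_fin, Finset.prod_eq_single j]
              · simp
              · intro i _ hij
                rw [Function.update_of_ne hij, ← ofReal_norm, hφ.1 i]; simp
              · simp
            -- Replacing φ_j by g keeps the family orthogonal, though no longer normalized, so
            -- Andréief's identity still applies.
            · have hgo : ∀ i, inner 𝕜 (φ i) g = 0 := fun i => by
                rw [hg, inner_sub_sum hφ]; simp
              intro i k hik
              by_cases hi : i = j
              · subst hi
                rw [Function.update_self, Function.update_of_ne hik.symm, ← inner_conj_symm, hgo,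
                  map_zero]
              · by_cases hk : k = j
                · subst hk
                  rw [Function.update_self, Function.update_of_ne hik, hgo]
                · rw [Function.update_of_ne hi, Function.update_of_ne hk, hφ.2 hik]
          · intro j _
            exact (measurable_det fun i k => (Lp.stronglyMeasurable _).measurable.comp
              (measurable_pi_apply k)).enorm.pow_const 2
      _ = m * ‖g‖ₑ ^ 2 := by
          rw [Finset.sum_const, Finset.card_univ, Fintype.card_fin, nsmul_eq_mul, ← mul_assoc,
            mul_comm _ (m : ℝ≥0∞), mul_assoc, ← mul_assoc _ _ (‖g‖ₑ ^ 2),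
            ENNReal.inv_mul_cancel hfac (by simp), one_mul]

end Estimable

/-! ### Iterative refinement of the coefficients -/

section Refine

variable {X : Type} {𝕜 : Type*} [MeasurableSpace X] [RCLike 𝕜] {μ : Measure X} {m : ℕ}

theorem sum_lintegral_mean_weightedProd_le {φ : Fin m → Lp 𝕜 2 μ} (hφ : Orthonormal 𝕜 φ)
    (hm : m ≠ 0) (κ : Type) [Fintype κ] [Nonempty κ] (r : Lp 𝕜 2 μ) :
    ∑ j, ∫⁻ x : κ → X, ‖(Fintype.card κ : 𝕜)⁻¹ * ∑ k, weightedProd φ r j (x k) -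
        inner 𝕜 (φ j) r‖ₑ ^ 2 ∂(Measure.pi fun _ => christoffelMeasure φ) ≤
      m / Fintype.card κ * ‖r‖ₑ ^ 2 := by
  have := isProbabilityMeasure_christoffelMeasure hφ hm
  simp only [← integral_weightedProd φ hm r]
  refine (Finset.sum_le_sum fun j _ => lintegral_enorm_mean_sub_integral_sq_le
    (memLp_weightedProd φ hm r j)).trans ?_
  rw [← Finset.mul_sum, div_eq_mul_inv, mul_comm (m : ℝ≥0∞), mul_assoc]
  exact mul_le_mul' le_rfl (sum_lintegral_weightedProd_le φ hm r)

/-- One step of iterative refinement: the coefficients of the residual are estimated by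
importance sampling. -/
theorem CoeffEstimable.refine {φ : Fin m → Lp 𝕜 2 μ} (hφ : Orthonormal 𝕜 φ)
    (hm : m ≠ 0) {ι : Type} {C : ℝ≥0∞} (h : CoeffEstimable φ ι C)
    (κ : Type) [Fintype κ] [Nonempty κ] :
    CoeffEstimable φ (ι ⊕ κ) (m / Fintype.card κ * (1 + C)) := by
  obtain ⟨Ω, _, ℙ, _, pt, coef, hpt, hcoef, hC⟩ := h
  have := isProbabilityMeasure_christoffelMeasure hφ hm
  have hφm := fun j => (Lp.stronglyMeasurable (φ j)).measurable
  have hqx : ∀ k : κ, Measure.QuasiMeasurePreserving (fun x : κ → X => x k)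
      (Measure.pi fun _ => christoffelMeasure φ) μ := fun k =>
    (Measure.quasiMeasurePreserving_eval (fun _ => christoffelMeasure φ) k).mono_right
      (withDensity_absolutelyContinuous _ _)
  -- Old estimate plus empirical means, over fresh points, of the weighted products of the residual
  -- f - Σ c_l φ_l. The residual is computable at these points from the samples of f.
  set coef' : Ω × (κ → X) → (ι ⊕ κ → 𝕜) → Fin m → 𝕜 := fun p y j =>
    coef p.1 (fun i => y (Sum.inl i)) j + (Fintype.card κ : 𝕜)⁻¹ * ∑ k,
      (y (Sum.inr k) - ∑ l, coef p.1 (fun i => y (Sum.inl i)) l * φ l (p.2 k)) *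
        (starRingEnd 𝕜) (φ j (p.2 k)) * (((christoffel φ (p.2 k) : ℝ)⁻¹ : ℝ) : 𝕜) with hcoef'
  have hm' : Measurable (Function.uncurry coef') := by
    have hc : ∀ l, Measurable fun q : (Ω × (κ → X)) × (ι ⊕ κ → 𝕜) =>
        coef q.1.1 (fun i => q.2 (Sum.inl i)) l := fun l =>
      (measurable_pi_apply l).comp (hcoef.comp ((measurable_fst.comp measurable_fst).prodMk
        (measurable_pi_lambda _ fun i => (measurable_pi_apply _).comp measurable_snd)))
    have hx : ∀ k, Measurable fun q : (Ω × (κ → X)) × (ι ⊕ κ → 𝕜) => q.1.2 k := fun k =>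
      (measurable_pi_apply k).comp (measurable_snd.comp measurable_fst)
    have hy : ∀ k, Measurable fun q : (Ω × (κ → X)) × (ι ⊕ κ → 𝕜) => q.2 (Sum.inr k) := fun k =>
      (measurable_pi_apply _).comp measurable_snd
    refine measurable_pi_lambda _ fun j => (hc j).add (Measurable.const_mul
      (Finset.measurable_fun_sum _ fun k _ => Measurable.mul (Measurable.mul ((hy k).sub
        (Finset.measurable_fun_sum _ fun l _ => (hc l).mul ((hφm l).comp (hx k)))) ?_) ?_) _)
    · exact RCLike.continuous_conj.measurable.comp ((hφm j).comp (hx k))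
    · exact RCLike.continuous_ofReal.measurable.comp
        (((measurable_christoffel φ).comp (hx k)).coe_nnreal_real.inv)
  refine ⟨Ω × (κ → X), inferInstance, ℙ.prod (Measure.pi fun _ => christoffelMeasure φ),
    inferInstance, Sum.elim (fun i p => pt i p.1) (fun k p => p.2 k), coef', ?_, hm', fun f => ?_⟩
  · rintro (i | k)
    · exact (hpt i).comp Measure.quasiMeasurePreserving_fst
    · exact (hqx k).comp Measure.quasiMeasurePreserving_snd
  have hfm := (Lp.stronglyMeasurable f).measurable
  set g := f - ∑ j, inner 𝕜 (φ j) f • φ j with hg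
  set c : Ω → Fin m → 𝕜 := fun ω => coef ω fun i => f (pt i ω) with hc
  have hmeas : Measurable fun p : Ω × (κ → X) => ∑ j, ‖coef' p (fun i =>
      f (Sum.elim (fun i (p : Ω × (κ → X)) => pt i p.1) (fun k p => p.2 k) i p)) j -
        inner 𝕜 (φ j) f‖ₑ ^ 2 := by
    refine Finset.measurable_fun_sum _ fun j _ => Measurable.pow_const (Measurable.enorm
      (((measurable_pi_apply j).comp (hm'.comp (measurable_id.prodMk
        (measurable_pi_lambda _ fun i => hfm.comp ?_)))).sub_const _)) 2
    rcases i with i | k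
    · exact (hpt i).measurable.comp measurable_fst
    · exact (measurable_pi_apply k).comp measurable_snd
  have hinner : ∀ ω, ∫⁻ x : κ → X, ∑ j, ‖coef' (ω, x) (fun i =>
      f (Sum.elim (fun i (p : Ω × (κ → X)) => pt i p.1) (fun k p => p.2 k) i (ω, x))) j -
        inner 𝕜 (φ j) f‖ₑ ^ 2 ∂(Measure.pi fun _ => christoffelMeasure φ) ≤
      m / Fintype.card κ * (‖g‖ₑ ^ 2 + ∑ j, ‖c ω j - inner 𝕜 (φ j) f‖ₑ ^ 2) := by
    intro ω
    -- For fixed ω the right-hand side is m / card κ times the squared norm of the residual, which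
    -- is the variance bound for the fresh samples.
    rw [← enorm_sub_sum_sq hφ]
    set r := f - ∑ l, c ω l • φ l with hr
    refine le_trans (le_of_eq ?_) (sum_lintegral_mean_weightedProd_le hφ hm κ r)
    have hZ : ∀ j k, AEMeasurable (fun x : κ → X => weightedProd φ r j (x k))
        (Measure.pi fun _ => christoffelMeasure φ) := fun j k =>
      (aestronglyMeasurable_weightedProd φ r j _).aemeasurable.comp_quasiMeasurePreserving
        (Measure.quasiMeasurePreserving_eval (fun _ => christoffelMeasure φ) k)
    rw [← lintegral_finsetSum' _ fun j _ => AEMeasurable.pow_const (AEMeasurable.enorm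
      (((Finset.aemeasurable_fun_sum _ fun k _ => hZ j k).const_mul _).sub_const _)) 2]
    refine lintegral_congr_ae ?_
    have hae : ∀ᵐ x ∂(Measure.pi fun _ : κ => christoffelMeasure φ), ∀ k,
        r (x k) = f (x k) - ∑ l, c ω l * φ l (x k) :=
      ae_all_iff.2 fun k => (hqx k).ae_eq_comp (lp_coeFn_sub_sum φ f (c ω))
    filter_upwards [hae] with x hx
    refine Finset.sum_congr rfl fun j _ => ?_
    congr 2
    simp only [hcoef', Sum.elim_inl, Sum.elim_inr, weightedProd, hx]
    rw [hr, inner_sub_sum hφ]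
    ring
  rw [lintegral_prod _ hmeas.aemeasurable]
  refine (lintegral_mono hinner).trans ?_
  rw [lintegral_const_mul' _ _ (ENNReal.div_ne_top (by simp) (by simp)), lintegral_add_left measurable_const, lintegral_const, measure_univ, mul_one, mul_assoc,
    add_mul, one_mul]
  exact mul_le_mul' le_rfl (add_le_add le_rfl (hC f))

/-- With `m + 2mk + mR` samples, where `2 ^ k ≥ m`, the coefficients are estimated with constant
`3 / R`. -/
theorem exists_coeffEstimable [IsProbabilityMeasure μ] {φ : Fin m → Lp 𝕜 2 μ}
    (hφ : Orthonormal 𝕜 φ) (hm : m ≠ 0) {k R : ℕ} (hk : m ≤ 2 ^ k) (hR : R ≠ 0) :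
    ∃ (ι : Type) (_ : Fintype ι), Fintype.card ι = m + 2 * m * k + m * R ∧
      CoeffEstimable φ ι (3 / R) := by
  have hm0 : (m : ℝ≥0∞) ≠ 0 := by simpa using hm
  -- Each round with 2m samples maps 1 + a to 1 + a/2. The start C = m is relaxed to 1 + m to fit
  -- this form.
  have key : ∀ k : ℕ, ∃ (ι : Type) (_ : Fintype ι), Fintype.card ι = m + 2 * m * k ∧
      CoeffEstimable φ ι (1 + m / 2 ^ k) := by
    intro k
    induction k with
    | zero =>
      obtain ⟨Ω, i1, ℙ, i2, pt, coef, h1, h2, h3⟩ := coeffEstimable_fin hφ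
      refine ⟨Fin m, inferInstance, by simp, Ω, i1, ℙ, i2, pt, coef, h1, h2, fun f =>
        (h3 f).trans (mul_le_mul' ?_ le_rfl)⟩
      simp
    | succ k ih =>
      obtain ⟨ι, _, hcard, h⟩ := ih
      have : Nonempty (Fin (2 * m)) := ⟨⟨0, by omega⟩⟩
      have h' := h.refine hφ hm (Fin (2 * m))
      refine ⟨ι ⊕ Fin (2 * m), inferInstance, by simp [hcard]; ring, ?_⟩
      convert h' using 1
      have e1 : (m : ℝ≥0∞) / (Fintype.card (Fin (2 * m)) : ℕ) = 2⁻¹ := by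
        rw [Fintype.card_fin, Nat.cast_mul, mul_comm, Nat.cast_ofNat, ENNReal.div_eq_inv_mul,
          ENNReal.mul_inv (by simp) (by simp), mul_comm (_⁻¹), mul_assoc,
          ENNReal.inv_mul_cancel hm0 (by simp), mul_one]
      rw [e1, ← add_assoc, one_add_one_eq_two, mul_add, ENNReal.inv_mul_cancel (by simp) (by simp),
        pow_succ, ENNReal.div_eq_inv_mul, ENNReal.div_eq_inv_mul,
        ENNReal.mul_inv (by simp) (by simp)]
      ring
  obtain ⟨ι, _, hcard, h⟩ := key k
  have : Nonempty (Fin (m * R)) := ⟨⟨0, Nat.pos_of_ne_zero (mul_ne_zero hm hR)⟩⟩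
  obtain ⟨Ω, i1, ℙ, i2, pt, coef, h1, h2, h3⟩ := h.refine hφ hm (Fin (m * R))
  refine ⟨ι ⊕ Fin (m * R), inferInstance, by simp [hcard], Ω, i1, ℙ, i2, pt, coef, h1, h2,
    fun f => (h3 f).trans (mul_le_mul' ?_ le_rfl)⟩
  have e1 : (m : ℝ≥0∞) / (Fintype.card (Fin (m * R)) : ℕ) = (R : ℝ≥0∞)⁻¹ := by
    rw [Fintype.card_fin, Nat.cast_mul, ENNReal.div_eq_inv_mul,
      ENNReal.mul_inv (by simp) (by simp), mul_comm, ← mul_assoc,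
      ENNReal.mul_inv_cancel hm0 (by simp), one_mul]
  have e2 : (m : ℝ≥0∞) / 2 ^ k ≤ 1 := by
    refine ENNReal.div_le_of_le_mul ?_
    rw [one_mul]; exact_mod_cast hk
  rw [e1, div_eq_mul_inv 3, mul_comm 3]
  refine mul_le_mul' le_rfl ?_
  calc (1 : ℝ≥0∞) + (1 + m / 2 ^ k) ≤ 1 + (1 + 1) := by gcongr
    _ = 3 := by norm_num

end Refine

/-! ### From coefficient estimates to randomized algorithms -/

section Randomized

variable {d : ℕ} {W : WeightedDomain d} {𝕜 : Type*} [RCLike 𝕜] {F : Type*}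
  [NormedAddCommGroup F] [InnerProductSpace 𝕜 F]

instance WeightedDomain.isProbabilityMeasure_μ (W : WeightedDomain d) :
    IsProbabilityMeasure W.μ := by
  constructor
  rw [WeightedDomain.μ, withDensity_apply _ MeasurableSet.univ, Measure.restrict_univ,
    W.lintegral_ρ]

theorem RanMethod.cost_eq {A : RanMethod W 𝕜} {n : ℕ} (hA : ∀ k ω y, A.halt k ω y ↔ k = n)
    (f : W.D → 𝕜) (ω : A.Ω) : A.cost f ω = n := by
  simp [RanMethod.cost, hA]

theorem RanMethod.run_eq {A : RanMethod W 𝕜} {n : ℕ} (hA : ∀ k ω y, A.halt k ω y ↔ k = n)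
    (f : W.D → 𝕜) (ω : A.Ω) : A.run f ω = A.out n ω fun i => f (A.point i ω) := by
  classical
  have h : ∃ k : ℕ, A.halt k ω fun i => f (A.point i ω) := ⟨n, (hA _ _ _).2 rfl⟩
  have hn : Nat.find h = n := (hA _ _ _).1 (Nat.find_spec h)
  rw [RanMethod.run, dif_pos h]
  have : ∀ k, k = n → (A.out k ω fun i => f (A.point i ω)) =
      A.out n ω fun i => f (A.point i ω) := by
    rintro k rfl; rfl
  refine Eq.trans ?_ (this _ hn)
  congr!

/-- The algorithm always uses exactly n samples and outputs Σ c_l φ_l; its mean square error splits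
into the squared distance to the span and the coefficient error. -/
theorem eRan_le_of_coeffEstimable (P : Problem W 𝕜 F) {m n : ℕ} {φ : Fin m → W.G 𝕜}
    (hφ : Orthonormal 𝕜 φ) {ι : Type} [Fintype ι] (hι : Fintype.card ι = n) (hn : n ≠ 0)
    {C : ℝ≥0∞} (h : CoeffEstimable φ ι C) {t : ℝ}
    (hV : ∀ f : F, ‖f‖ ≤ 1 → ‖P.app f - ∑ j, inner 𝕜 (φ j) (P.app f) • φ j‖ ≤ t) :
    eRan P n ≤ ((1 + C) * ENNReal.ofReal t ^ 2) ^ (1 / 2 : ℝ) := by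
  obtain ⟨Ω, _, ℙ, _, pt, coef, hpt, hcoef, hC⟩ := h
  obtain ⟨x₀⟩ : Nonempty W.D := nonempty_of_isProbabilityMeasure W.μ
  let e : ι ≃ Fin n := Fintype.equivFinOfCardEq hι
  let M : RanMethod W 𝕜 :=
    { Ω := Ω
      ℙ := ℙ
      -- The filler x₀ is never sampled, since the method halts after n values.
      point := fun j ω => if hj : j < n then pt (e.symm ⟨j, hj⟩) ω else x₀
      halt := fun k _ _ => k = n
      out := fun k ω y => ∑ l, coef ω (fun i => if hi : (e i : ℕ) < k then y ⟨e i, hi⟩ else 0) l •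
        φ l }
  have hhalt : ∀ k ω y, M.halt k ω y ↔ k = n := fun _ _ _ => Iff.rfl
  have hrun : ∀ f ω, M.run f ω = ∑ l, coef ω (fun i => f (pt i ω)) l • φ l := by
    intro f ω
    rw [M.run_eq hhalt]
    simp [M]
  have hmeas : ∀ f : W.D → 𝕜, Measurable f → ∀ l,
      Measurable fun ω => coef ω (fun i => f (pt i ω)) l := fun f hf l =>
    (measurable_pi_apply l).comp (hcoef.comp (measurable_id.prodMk
      (measurable_pi_lambda _ fun i => hf.comp (hpt i).measurable)))
  have hsm : ∀ f : P.E, (fun ω => M.run f ω) =ᵐ[ℙ]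
      fun ω => ∑ l, coef ω (fun i => P.app (P.cls f) (pt i ω)) l • φ l := by
    intro f
    -- The law of each sample point is absolutely continuous with respect to μ, so almost surely
    -- every representative of f has the same values at the finitely many points.
    have hae : ∀ᵐ ω ∂ℙ, ∀ i, P.app (P.cls f) (pt i ω) = (f : W.D → 𝕜) (pt i ω) :=
      ae_all_iff.2 fun i => (hpt i).ae_eq_comp (P.app_cls f)
    filter_upwards [hae] with ω hω
    rw [hrun]
    simp only [hω]
  let A : RanAlg P :=
    { toRanMethod := M
      measurable_point := fun j => by
        by_cases hj : j < n
        · simpa [M, hj] using (hpt _).measurable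
        · simp [M, hj]
      measurableSet_halt := fun k ω => by simp [M]
      stronglyMeasurable_out := fun k ω => by
        have hs : ∀ l, Measurable fun y : Fin k → 𝕜 =>
            coef ω (fun i => if hi : (e i : ℕ) < k then y ⟨e i, hi⟩ else 0) l := fun l => by
          refine (measurable_pi_apply l).comp (hcoef.comp (measurable_const.prodMk
            (measurable_pi_lambda _ fun i => ?_)))
          change Measurable fun y : Fin k → 𝕜 =>
            if hi : (e i : ℕ) < k then y ⟨e i, hi⟩ else 0
          split_ifs with hi
          · exact measurable_pi_apply _
          · exact measurable_const
        change StronglyMeasurable fun y : Fin k → 𝕜 => ∑ l,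
          coef ω (fun i => if hi : (e i : ℕ) < k then y ⟨e i, hi⟩ else 0) l • φ l
        exact Finset.stronglyMeasurable_fun_sum _ fun l _ =>
          (hs l).stronglyMeasurable.smul_const _
      aemeasurable_cost := fun f _ => by
        have : M.cost f = fun _ => (n : ℝ≥0∞) := funext fun ω => M.cost_eq hhalt f ω
        rw [this]
        exact aemeasurable_const
      aestronglyMeasurable_run := fun f hf => by
        refine ⟨_, ?_, hsm ⟨f, hf⟩⟩
        exact Finset.stronglyMeasurable_fun_sum _ fun l _ =>
          (hmeas _ (Lp.stronglyMeasurable _).measurable l).stronglyMeasurable.smul_const _ }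
  have hcard : A.card ≤ n := by
    refine iSup₂_le fun f _ => ?_
    simp only [A, M.cost_eq hhalt, lintegral_const]
    rw [show M.ℙ = ℙ from rfl, measure_univ, mul_one]
  rw [eRan, if_neg hn]
  refine iInf₂_le_of_le A hcard (iSup₂_le fun f hf => ENNReal.rpow_le_rpow ?_ (by norm_num))
  set u := P.app (P.cls f) with hu
  calc ∫⁻ ω, ‖u - M.run (f : W.D → 𝕜) ω‖ₑ ^ 2 ∂ℙ
      = ∫⁻ ω, (‖u - ∑ l, inner 𝕜 (φ l) u • φ l‖ₑ ^ 2 +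
          ∑ l, ‖coef ω (fun i => u (pt i ω)) l - inner 𝕜 (φ l) u‖ₑ ^ 2) ∂ℙ := by
        refine lintegral_congr_ae ?_
        filter_upwards [hsm f] with ω hω
        rw [hω, enorm_sub_sum_sq hφ]
    _ ≤ (1 + C) * ‖u - ∑ l, inner 𝕜 (φ l) u • φ l‖ₑ ^ 2 := by
        rw [lintegral_add_left measurable_const, lintegral_const, measure_univ, mul_one,
          add_mul, one_mul]
        exact add_le_add le_rfl (hC u)
    _ ≤ (1 + C) * ENNReal.ofReal t ^ 2 := by
        rw [← ofReal_norm]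
        have := hV _ hf
        gcongr

theorem eRan_zero (P : Problem W 𝕜 F) : eRan P 0 = initialError P := if_pos rfl

theorem eWor_zero (P : Problem W 𝕜 F) : eWor P 0 = initialError P := if_pos rfl

/-- If the worst case error with `n` functionals is at most `t`, then `m + 2mk + mR` random samples
suffice for the error `(1 + 3/R)^{1/2} t`, for some `m ≤ n` and any `k` with `n ≤ 2 ^ k`. -/
theorem exists_eRan_le [CompleteSpace F] (P : Problem W 𝕜 F) {n k R : ℕ} {t : ℝ} (ht : 0 ≤ t)
    (h : eWor P n ≤ ENNReal.ofReal t) (hk : n ≤ 2 ^ k) (hR : R ≠ 0) :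
    ∃ m ≤ n, eRan P (m + 2 * m * k + m * R) ≤ ENNReal.ofReal (√(1 + 3 / R) * t) := by
  have hone : (1 : ℝ) ≤ √(1 + 3 / R) := by
    rw [Real.one_le_sqrt]
    have : (0 : ℝ) ≤ 3 / R := by positivity
    linarith
  by_cases hn : n = 0
  · subst hn
    refine ⟨0, le_rfl, ?_⟩
    simp only [zero_mul, mul_zero, add_zero]
    rw [eRan_zero, ← eWor_zero]
    exact h.trans (ENNReal.ofReal_le_ofReal (le_mul_of_one_le_left ht hone))
  obtain ⟨V, _, hVn, hV⟩ := exists_submodule_of_eWor_le P hn ht h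
  obtain ⟨φ, hφ, hbest⟩ := exists_orthonormal_norm_sub_le V
  have hle : ∀ f : F, ‖f‖ ≤ 1 → ‖P.app f - ∑ j, inner 𝕜 (φ j) (P.app f) • φ j‖ ≤ t := by
    intro f hf
    obtain ⟨v, hv, hvle⟩ := hV f
    exact (hbest _ v hv).trans (hvle.trans (mul_le_of_le_one_right ht hf))
  refine ⟨Module.finrank 𝕜 V, hVn, ?_⟩
  -- If V = 0, then zero samples are claimed and the zero algorithm itself has error at most t.
  by_cases hm : Module.finrank 𝕜 V = 0
  · have hemp : IsEmpty (Fin (Module.finrank 𝕜 V)) := by rw [hm]; infer_instance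
    simp only [hm, zero_mul, mul_zero, add_zero]
    rw [eRan_zero]
    refine iSup₂_le fun f hf => ?_
    rw [← ofReal_norm]
    refine ENNReal.ofReal_le_ofReal (le_trans ?_ (le_mul_of_one_le_left ht hone))
    simpa using hle f hf
  · obtain ⟨ι, _, hι, hest⟩ := exists_coeffEstimable hφ hm (hVn.trans hk) hR
    refine (eRan_le_of_coeffEstimable P hφ hι (by omega) hest hle).trans (le_of_eq ?_)
    have h1 : (1 : ℝ≥0∞) + 3 / R = ENNReal.ofReal (1 + 3 / R) := by
      rw [ENNReal.ofReal_add (by norm_num) (by positivity), ENNReal.ofReal_div_of_pos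
        (by positivity)]
      simp
    rw [h1, ← ENNReal.ofReal_pow ht, ← ENNReal.ofReal_mul (by positivity),
      ENNReal.ofReal_rpow_of_nonneg (by positivity) (by norm_num), ← Real.sqrt_eq_rpow,
      Real.sqrt_mul (by positivity), Real.sqrt_sq ht]

end Randomized

/-! ### Information complexities -/

section Complexity

/-- The factor `CRI` of an error criterion. -/
def Criterion.factor (c : Criterion) (e₀ : ℝ≥0∞) : ℝ≥0∞ :=
  match c with
  | .ABS => 1
  | .NOR => e₀

theorem complexity_le {e : ℕ → ℝ≥0∞} {c : Criterion} {ε : ℝ} {n : ℕ}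
    (h : e n ≤ ENNReal.ofReal ε * c.factor (e 0)) : complexity e c ε ≤ n :=
  iInf₂_le_of_le n h le_rfl

theorem apply_toNat_complexity_le {e : ℕ → ℝ≥0∞} {c : Criterion} {ε : ℝ}
    (h : complexity e c ε ≠ ⊤) :
    e (complexity e c ε).toNat ≤ ENNReal.ofReal ε * c.factor (e 0) := by
  have h1 : complexity e c ε = ⨅ n : {n : ℕ // e n ≤ ENNReal.ofReal ε * c.factor (e 0)},
      ((n : ℕ) : ℕ∞) := iInf_subtype' (f := fun (n : ℕ)
        (_ : e n ≤ ENNReal.ofReal ε * c.factor (e 0)) => (n : ℕ∞))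
  have hne : Nonempty {n : ℕ // e n ≤ ENNReal.ofReal ε * c.factor (e 0)} := by
    by_contra hc
    rw [not_nonempty_iff] at hc
    exact h (by rw [h1, iInf_of_empty])
  obtain ⟨n, hn⟩ := ciInf_mem fun n : {n : ℕ // e n ≤ ENNReal.ofReal ε * c.factor (e 0)} =>
    ((n : ℕ) : ℕ∞)
  rw [h1, ← hn]
  simpa using n.2

variable {d : ℕ} {W : WeightedDomain d} {𝕜 : Type*} [RCLike 𝕜] {F : Type*}
  [NormedAddCommGroup F] [InnerProductSpace 𝕜 F]

theorem initialError_ne_top (P : Problem W 𝕜 F) : initialError P ≠ ⊤ := by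
  refine ne_top_of_le_ne_top (b := ENNReal.ofReal ‖P.app‖) ENNReal.ofReal_ne_top
    (iSup₂_le fun f hf => ?_)
  rw [← ofReal_norm]
  exact ENNReal.ofReal_le_ofReal (P.app.unit_le_opNorm f hf)

theorem exists_factor_eq (P : Problem W 𝕜 F) (c : Criterion) :
    ∃ s : ℝ, 0 ≤ s ∧ c.factor (initialError P) = ENNReal.ofReal s := by
  cases c
  · exact ⟨1, zero_le_one, by simp [Criterion.factor]⟩
  · exact ⟨_, ENNReal.toReal_nonneg, (ENNReal.ofReal_toReal (initialError_ne_top P)).symm⟩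

theorem nWor_ne_top (P : Problem W 𝕜 F) (c : Criterion) {ε : ℝ} (hε : 0 < ε) :
    nWor P c ε ≠ ⊤ := by
  obtain ⟨s, hs, hcri⟩ := exists_factor_eq P c
  suffices h : ∃ n, eWor P n ≤ ENNReal.ofReal ε * c.factor (eWor P 0) by
    obtain ⟨n, hn⟩ := h
    exact ne_top_of_le_ne_top (ENat.natCast_ne_top n) (complexity_le hn)
  rw [eWor_zero, hcri]
  -- If CRI = 0, the criterion is normalized and T = 0, so n = 0 already suffices; compactness
  -- yields only positive error levels.
  rcases hs.eq_or_lt with rfl | hs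
  · cases c with
    | ABS => simp [Criterion.factor] at hcri
    | NOR =>
      refine ⟨0, ?_⟩
      rw [eWor_zero, show initialError P = ENNReal.ofReal 0 from hcri]
      simp
  · rw [← ENNReal.ofReal_mul hε.le]
    exact exists_eWor_le P (mul_pos hε hs)

theorem nRan_le [CompleteSpace F] (P : Problem W 𝕜 F) (c : Criterion) {ε a : ℝ} (hε : 0 < ε)
    {k R : ℕ} (hR : R ≠ 0) (ha : √(1 + 3 / R) ≤ a) (hk : (nWor P c (ε / a)).toNat ≤ 2 ^ k) :
    nRan P c ε ≤ (((nWor P c (ε / a)).toNat * (1 + 2 * k + R) : ℕ) : ℕ∞) := by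
  have ha0 : 0 < a := lt_of_lt_of_le (Real.sqrt_pos.2 (by positivity)) ha
  obtain ⟨s, hs, hcri⟩ := exists_factor_eq P c
  have hN := apply_toNat_complexity_le (nWor_ne_top P c (div_pos hε ha0))
  change eWor P (nWor P c (ε / a)).toNat ≤ _ at hN
  rw [eWor_zero, hcri, ← ENNReal.ofReal_mul (by positivity)] at hN
  obtain ⟨m, hm, hle⟩ := exists_eRan_le P (by positivity) hN hk hR
  refine (complexity_le (n := m + 2 * m * k + m * R) ?_).trans (Nat.cast_le.2 ?_)
  · rw [eRan_zero, hcri, ← ENNReal.ofReal_mul hε.le]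
    refine hle.trans (ENNReal.ofReal_le_ofReal ?_)
    calc √(1 + 3 / R) * (ε / a * s) ≤ a * (ε / a * s) := by gcongr
      _ = ε * s := by field_simp
  · calc m + 2 * m * k + m * R = m * (1 + 2 * k + R) := by ring
      _ ≤ _ := Nat.mul_le_mul_right _ hm

theorem toNat_nRan_le [CompleteSpace F] (P : Problem W 𝕜 F) (c : Criterion) {ε a : ℝ}
    (hε : 0 < ε) {R : ℕ} (hR : R ≠ 0) (ha : √(1 + 3 / R) ≤ a) :
    nRan P c ε ≠ ⊤ ∧ ((nRan P c ε).toNat : ℝ) ≤ (nWor P c (ε / a)).toNat *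
      (3 + 4 * Real.log ((nWor P c (ε / a)).toNat + 1) + R) := by
  set N := (nWor P c (ε / a)).toNat with hN
  -- k = ⌊log₂ N⌋ + 1 ensures N ≤ 2^k, also for N = 0.
  have h := nRan_le P c hε hR ha (k := Nat.log 2 N + 1)
    (Nat.lt_pow_succ_log_self one_lt_two N).le
  rw [← hN] at h
  refine ⟨ne_top_of_le_ne_top (ENat.natCast_ne_top _) h, ?_⟩
  have h1 : (nRan P c ε).toNat ≤ N * (1 + 2 * (Nat.log 2 N + 1) + R) := ENat.toNat_le_of_le_natCast h
  -- Uses ln 2 > 1/2.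
  have h2 : (Nat.log 2 N : ℝ) ≤ 2 * Real.log (N + 1) := by
    rcases Nat.eq_zero_or_pos N with h0 | h0
    · simp [h0]
    · have h3 : ((2 : ℝ)) ^ Nat.log 2 N ≤ N + 1 := by
        exact_mod_cast (Nat.pow_log_le_self 2 h0.ne').trans (Nat.le_succ N)
      have h4 := Real.log_le_log (by positivity) h3
      rw [Real.log_pow] at h4
      have h5 := Real.log_two_gt_d9
      have h6 : (0 : ℝ) ≤ Nat.log 2 N := by positivity
      nlinarith
  calc ((nRan P c ε).toNat : ℝ) ≤ N * (1 + 2 * (Nat.log 2 N + 1) + R) := by exact_mod_cast h1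
    _ ≤ N * (3 + 4 * Real.log (N + 1) + R) := by
      refine mul_le_mul_of_nonneg_left ?_ (Nat.cast_nonneg N)
      linarith

theorem tendsto_Aδ : Filter.Tendsto Aδ (nhdsWithin 0 (Set.Ioi 0)) (nhds 1) := by
  have h1 : Filter.Tendsto (fun δ : ℝ => 1 / (12 * Real.log (1 / δ)))
      (nhdsWithin 0 (Set.Ioi 0)) (nhds 0) := by
    simp only [one_div]
    exact tendsto_inv_atTop_zero.comp ((Real.tendsto_log_atTop.comp
      tendsto_inv_nhdsGT_zero).const_mul_atTop (by norm_num))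
  have h2 : Filter.Tendsto (fun δ : ℝ => 1 / √(1 - δ)) (nhdsWithin 0 (Set.Ioi 0)) (nhds 1) := by
    have : ContinuousAt (fun δ : ℝ => 1 / √(1 - δ)) 0 := by
      refine continuousAt_const.div (by fun_prop) (by simp)
    simpa [ContinuousAt] using this.tendsto.mono_left nhdsWithin_le_nhds
  have h3 := ((h1.const_add 1).sqrt).mul h2
  rw [add_zero, Real.sqrt_one, one_mul] at h3
  exact h3

theorem le_Aδ {δ : ℝ} (h0 : 0 < δ) (h1 : δ < 1) :
    √(1 + 1 / (12 * Real.log (1 / δ))) ≤ Aδ δ := by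
  refine le_mul_of_one_le_right (Real.sqrt_nonneg _) ?_
  rw [one_le_div (Real.sqrt_pos.2 (by linarith)), Real.sqrt_le_one]
  linarith

end Complexity

end RandApprox

end

/-! ### Choice of the number R of final samples per dimension -/

theorem theorem2p3 (𝕜 : Type*) [RCLike 𝕜] :
    -- first bound
    (∀ (d : ℕ) (W : RandApprox.WeightedDomain d) (F : Type*) [NormedAddCommGroup F]
        [InnerProductSpace 𝕜 F] [CompleteSpace F] [TopologicalSpace.SeparableSpace F]
        (P : RandApprox.Problem W 𝕜 F) (c : RandApprox.Criterion) (ε : ℝ), 0 < ε →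
      RandApprox.nWor P c (ε / 4) ≠ ⊤ ∧ RandApprox.nRan P c ε ≠ ⊤ ∧
      ((RandApprox.nRan P c ε).toNat : ℝ) ≤
        96 * √2 * (((RandApprox.nWor P c (ε / 4)).toNat : ℝ) + 1) *
          (Real.log (((RandApprox.nWor P c (ε / 4)).toNat : ℝ) + 1) + Real.log (192 * √2))) ∧
    -- second bound, for all sufficiently small `δ`
    (∃ δ₀ : ℝ, 0 < δ₀ ∧ δ₀ < 1 ∧ ∀ δ : ℝ, 0 < δ → δ < δ₀ →
      ∀ (d : ℕ) (W : RandApprox.WeightedDomain d) (F : Type*) [NormedAddCommGroup F]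
        [InnerProductSpace 𝕜 F] [CompleteSpace F] [TopologicalSpace.SeparableSpace F]
        (P : RandApprox.Problem W 𝕜 F) (c : RandApprox.Criterion) (ε : ℝ), 0 < ε →
      RandApprox.nWor P c (ε / RandApprox.Aδ δ) ≠ ⊤ ∧ RandApprox.nRan P c ε ≠ ⊤ ∧
      ((RandApprox.nRan P c ε).toNat : ℝ) ≤
        48 * (4 * (Real.log 48 + Real.log (Real.log (1 / δ)) +
            Real.log (((RandApprox.nWor P c (ε / RandApprox.Aδ δ)).toNat : ℝ) + 1)) +
          Real.log (1 / δ)) *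
          (((RandApprox.nWor P c (ε / RandApprox.Aδ δ)).toNat : ℝ) + 1)) ∧
    Filter.Tendsto RandApprox.Aδ (nhdsWithin 0 (Set.Ioi 0)) (nhds 1) := by
  -- δ₀ = 1/e makes ln(1/δ) ≥ 1, hence ln ln(1/δ) ≥ 0.
  refine ⟨fun d W F _ _ _ _ P c ε hε => ?_, ⟨Real.exp (-1), Real.exp_pos _, by simp, ?_⟩,
    RandApprox.tendsto_Aδ⟩
  -- R = 1 gives the error factor √(1 + 3) = 2 ≤ 4.
  · obtain ⟨h1, h2⟩ := RandApprox.toNat_nRan_le P c (a := 4) hε one_ne_zero (by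
      rw [Real.sqrt_le_left (by norm_num)]; norm_num)
    refine ⟨RandApprox.nWor_ne_top P c (by positivity), h1, h2.trans ?_⟩
    set N : ℝ := ((RandApprox.nWor P c (ε / 4)).toNat : ℝ)
    have hN : 0 ≤ N := Nat.cast_nonneg _
    have hl : 0 ≤ Real.log (N + 1) := Real.log_nonneg (by linarith)
    have hs : (1 : ℝ) ≤ √2 := by rw [Real.one_le_sqrt]; norm_num
    have hc : 1 ≤ Real.log (192 * √2) := by
      rw [Real.le_log_iff_exp_le (by positivity)]
      have := Real.exp_one_lt_d9
      linarith
    calc N * (3 + 4 * Real.log (N + 1) + (1 : ℕ))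
        = 4 * N * (Real.log (N + 1) + 1) := by push_cast; ring
      _ ≤ 96 * √2 * (N + 1) * (Real.log (N + 1) + Real.log (192 * √2)) := by
        gcongr <;> linarith
  · intro δ h0 hδ d W F _ _ _ _ P c ε hε
    have hδ1 : δ < 1 := hδ.trans (by simp)
    have hL : 1 ≤ Real.log (1 / δ) := by
      rw [one_div, Real.log_inv, le_neg]
      exact (Real.log_le_iff_le_exp h0).2 hδ.le
    set L := Real.log (1 / δ) with hLdef
    have hLL : 0 ≤ Real.log L := Real.log_nonneg hL
    -- R = ⌈36 L⌉ makes 3/R ≤ 1/(12 L), the term in the first factor of A_δ; the factor (1 -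
    -- δ)^{-1/2} ≥ 1 is slack.
    have hR0 : ⌈36 * L⌉₊ ≠ 0 := (Nat.ceil_pos.2 (by positivity)).ne'
    have hR : (⌈36 * L⌉₊ : ℝ) ≤ 36 * L + 1 := (Nat.ceil_lt_add_one (by positivity)).le
    have hA : √(1 + 3 / (⌈36 * L⌉₊ : ℝ)) ≤ RandApprox.Aδ δ := by
      refine le_trans (Real.sqrt_le_sqrt ?_) (RandApprox.le_Aδ h0 hδ1)
      rw [← hLdef, add_le_add_iff_left, div_le_div_iff₀ (by positivity) (by positivity)]
      linarith [Nat.le_ceil (36 * L)]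
    have hA0 : 0 < RandApprox.Aδ δ := lt_of_lt_of_le (Real.sqrt_pos.2 (by positivity)) hA
    obtain ⟨h1, h2⟩ := RandApprox.toNat_nRan_le P c hε hR0 hA
    refine ⟨RandApprox.nWor_ne_top P c (by positivity), h1, h2.trans ?_⟩
    set N : ℝ := ((RandApprox.nWor P c (ε / RandApprox.Aδ δ)).toNat : ℝ)
    have hN : 0 ≤ N := Nat.cast_nonneg _
    have hl : 0 ≤ Real.log (N + 1) := Real.log_nonneg (by linarith)
    have hc : 1 ≤ Real.log 48 := by
      rw [Real.le_log_iff_exp_le (by positivity)]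
      have := Real.exp_one_lt_d9
      linarith
    rw [mul_comm N]
    refine mul_le_mul ?_ (by linarith) hN (by positivity)
    linarith
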